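/- Let $d,M\ge 1$. A probability measure $\Omega$ on $\mathbb{R}^d$ is isotropic if it is invariant under all linear isometries. For isotropic $\Omega$ and $M\le d$, an orthogonal ensemble with marginals $\Omega$ is a family $\omega_m^{\mathrm{ort}}=r_m\mathbf{u}_m$, $m=1,\dots,M$, where $(\mathbf{u}_1,\dots,\mathbf{u}_M)$ is a uniformly distributed (rotation-invariant) orthonormal system, the $r_m$ are i.i.d. with the distribution $\tilde\Omega$ of $\|\omega\|$ for $\omega\sim\Omega$, and $(r_m)_m$ is independent of $(\mathbf{u}_m)_m$. For $M>d$, a block-orthogonal ensemble consists of independent consecutive blocks of $d$ samples (the last block possibly shorter), each block being an orthogonal ensemble. Let $\omega_1^{\mathrm{iid}},\dots,\omega_M^{\mathrm{iid}}$ be i.i.d. samples from $\Omega$. (i) Let $M\le d$, let $\Omega$ be isotropic (for example $\Omega=\mathcal{N}(\mathbf{0}_d,\mathbf{I}_d)$), $\mathbf{z}\in\mathbb{R}^d$, and let $g:\mathbb{R}\times\mathbb{R}_{\ge 0}\to\mathbb{R}$ be measurable such that for every $y\ge 0$ there are $a_0(y),a_1(y),\dots\ge 0$ with $g(x,y)=\sum_{k\ge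 0}a_k(y)x^k$ for all $x\in\mathbb{R}$. Suppose that $X=g(\omega^\top\mathbf{z},\|\omega\|)$, $\omega\sim\Omega$, has finite second moment. Then $$\widehat K_M^{\mathrm{iid}}=\frac1M\sum_{m=1}^M g\big((\omega_m^{\mathrm{iid}})^\top\mathbf{z},\|\omega_m^{\mathrm{iid}}\|\big),\qquad \widehat K_M^{\mathrm{ort}}=\frac1M\sum_{m=1}^M g\big((\omega_m^{\mathrm{ort}})^\top\mathbf{z},\|\omega_m^{\mathrm{ort}}\|\big)$$ are square-integrable unbiased estimators of $\mathbb{E}[X]$, and $$\mathrm{Var}(\widehat K_M^{\mathrm{ort}})\le \mathrm{Var}(\widehat K_M^{\mathrm{iid}})-\Big(1-\frac1M\Big)\frac{2}{d+2}F(\mathbf{z})^2,$$ where $F(\mathbf{z})=\mathbb{E}_{\mathbf{u}\sim\mathrm{Unif}(\mathcal{S}^{d-1})}\mathbb{E}_{t\sim\tilde\Omega}\big[\tilde g(t\,\mathbf{u}^\top\mathbf{z},t)\big]$ and $\tilde g(a,b)=\frac{g(a,b)+g(-a,b)}{2}-g(0,b)$. (ii) For $\mathbf{x},\mathbf{y}\in\mathbb{R}^d$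 and $\Omega=\mathcal{N}(\mathbf{0}_d,\mathbf{I}_d)$, consider the optimal positive random feature (OPRF) estimators of the Gaussian kernel $\exp(-\frac12\|\mathbf{x}-\mathbf{y}\|^2)$, $$\widehat K_M(\mathbf{x},\mathbf{y})=\frac1M\sum_{m=1}^M f(\omega_m,\mathbf{x})f(\omega_m,\mathbf{y}),\qquad f(\omega,\mathbf{v})=D\exp\big(A\|\omega\|^2+B\,\omega^\top\mathbf{v}-\|\mathbf{v}\|^2\big),$$ where, with $q=\|\mathbf{x}+\mathbf{y}\|^2$, $\rho^*=\big(\sqrt{(2q+d)^2+8dq}-2q-d\big)/(4q)$ if $q>0$ and $\rho^*=1$ if $q=0$, one puts $A=(1-1/\rho^*)/8$, $B=\sqrt{1-4A}$, $D=(1-4A)^{d/4}$. The summands are $g(\omega_m^\top\mathbf{z},\|\omega_m\|)$ with $\mathbf{z}=\mathbf{x}+\mathbf{y}$ and $g(a,b)=D^2\exp(2Ab^2+Ba-\|\mathbf{x}\|^2-\|\mathbf{y}\|^2)$. If $M\le d$, then $$\mathrm{Var}(\widehat K_M^{\mathrm{ort}}(\mathbf{x},\mathbf{y}))\le \mathrm{Var}(\widehat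 K_M^{\mathrm{iid}}(\mathbf{x},\mathbf{y}))-\Big(1-\frac1M\Big)\frac{2}{d+2}F(\mathbf{x}+\mathbf{y})^2,$$ with $F$ as in (i) for this $g$; explicitly, $F(\mathbf{x}+\mathbf{y})=e^{-\|\mathbf{x}\|^2-\|\mathbf{y}\|^2}\big(e^{\|\mathbf{x}+\mathbf{y}\|^2/2}-1\big)$. (iii) For every $M\ge 1$ (also $M>d$), the OPRF estimator built from a Gaussian block-orthogonal ensemble satisfies $\mathrm{Var}(\widehat K_M^{\mathrm{ort}}(\mathbf{x},\mathbf{y}))\le\mathrm{Var}(\widehat K_M^{\mathrm{iid}}(\mathbf{x},\mathbf{y}))$. -/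

import Mathlib

open MeasureTheory ProbabilityTheory
open scoped NNReal

noncomputable section

namespace OrthRF

/-- Euclidean space of dimension `d`. -/
abbrev E (d : ℕ) : Type := EuclideanSpace ℝ (Fin d)

/-- A measure on Euclidean space is isotropic if it is invariant under every linear isometry. -/
def IsIsotropic {d : ℕ} (ν : Measure (E d)) : Prop :=
  ∀ T : E d ≃ₗᵢ[ℝ] E d, ν.map T = ν

/-- The random vectors `ω i` are independent, each with law `ν`. -/
def IsIIDSample {d : ℕ} {Ω ι : Type*} [MeasurableSpace Ω] (ν : Measure (E d)) (P : Measure Ω)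
    (ω : ι → Ω → E d) : Prop :=
  (∀ i, HasLaw (ω i) ν P) ∧ iIndepFun ω P

/-- Orthogonal ensemble with isotropic marginals `ν`: `ω i = r i • u i`, where the directions `u`
form an orthonormal system whose joint law is invariant under every linear isometry (so it is the
uniform law on orthonormal frames), and the lengths `r i` are independent of each other and
of the directions, each distributed as the norm of a sample of `ν`. -/
def IsOrthogonalEnsemble {d : ℕ} {Ω ι : Type*} [MeasurableSpace Ω] [Fintype ι]
    (ν : Measure (E d)) (P : Measure Ω) (ω : ι → Ω → E d) : Prop :=
  ∃ (r : ι → Ω → ℝ) (u : ι → Ω → E d),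
    (∀ i, AEMeasurable (u i) P) ∧
    (∀ᵐ p ∂P, Orthonormal ℝ (fun i => u i p)) ∧
    (∀ T : E d ≃ₗᵢ[ℝ] E d,
      IdentDistrib (fun p => fun i => T (u i p)) (fun p => fun i => u i p) P P) ∧
    (∀ i, HasLaw (r i) (ν.map (fun w => ‖w‖)) P) ∧
    iIndepFun r P ∧
    IndepFun (fun p => fun i => r i p) (fun p => fun i => u i p) P ∧
    (∀ i, ω i =ᵐ[P] fun p => r i p • u i p)

/-- Block-orthogonal ensemble of `M` vectors in dimension `d`, for arbitrary `M`: the samples are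
split into consecutive blocks of length `d` (the last one may be shorter), each block is an
orthogonal ensemble, and the blocks are independent. -/
def IsBlockOrthogonalEnsemble {d M : ℕ} {Ω : Type*} [MeasurableSpace Ω]
    (ν : Measure (E d)) (P : Measure Ω) (ω : Fin M → Ω → E d) : Prop :=
  (∀ b : ℕ, IsOrthogonalEnsemble ν P (fun i : {m : Fin M // (m : ℕ) / d = b} => ω i)) ∧
  iIndepFun (fun (b : ℕ) (p : Ω) => fun i : {m : Fin M // (m : ℕ) / d = b} => ω i p) P

/-- For each fixed second argument, `g` is an everywhere convergent power series in its
first argument with nonnegative coefficients. -/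
def HasNonnegCoeffs (g : ℝ → ℝ≥0 → ℝ) : Prop :=
  ∀ y : ℝ≥0, ∃ a : ℕ → ℝ, (∀ k, 0 ≤ a k) ∧ ∀ x : ℝ, HasSum (fun k => a k * x ^ k) (g x y)

/-- The random variable `X = g (ωᵀ z, ‖ω‖)` as a function of `ω`. -/
def sampleValue {d : ℕ} (g : ℝ → ℝ≥0 → ℝ) (z w : E d) : ℝ :=
  g (inner ℝ w z) ‖w‖₊

/-- The Monte Carlo estimator `(1/M) ∑ₘ h (ωₘ)`. -/
def estimator {d M : ℕ} {Ω : Type*} (h : E d → ℝ) (ω : Fin M → Ω → E d) (p : Ω) : ℝ :=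
  (1 / (M : ℝ)) * ∑ m, h (ω m p)

/-- The even part of `g` in its first argument, minus the value at zero. -/
def gTilde (g : ℝ → ℝ≥0 → ℝ) (a : ℝ) (b : ℝ≥0) : ℝ :=
  (g a b + g (-a) b) / 2 - g 0 b

/-- The uniform probability distribution on the unit sphere. -/
def unifSphere (d : ℕ) : Measure (Metric.sphere (0 : E d) 1) :=
  ((volume : Measure (E d)).toSphere Set.univ)⁻¹ • (volume : Measure (E d)).toSphere

/-- `F(z) = 𝔼_u 𝔼_t [g̃ (t uᵀ z, t)]`, with `u` uniform on the unit sphere and `t` distributed as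
the norm of a sample of `ν`. -/
def F {d : ℕ} (g : ℝ → ℝ≥0 → ℝ) (ν : Measure (E d)) (z : E d) : ℝ :=
  ∫ u : Metric.sphere (0 : E d) 1,
    (∫ t : ℝ≥0, gTilde g ((t : ℝ) * inner ℝ (u : E d) z) t ∂(ν.map (fun w => ‖w‖₊)))
      ∂(unifSphere d)

/-- The optimal `ρ*` as a function of the dimension and of `q = ‖x + y‖²`
(with its limiting value `1` at `q = 0`). -/
def rhoStar (d : ℕ) (q : ℝ) : ℝ :=
  if q = 0 then 1
  else (Real.sqrt ((2 * q + d) ^ 2 + 8 * d * q) - 2 * q - d) / (4 * q)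

/-- The parameter `A = (1 - 1/ρ*) / 8`. -/
def oprfA {d : ℕ} (x y : E d) : ℝ := (1 - 1 / rhoStar d (‖x + y‖ ^ 2)) / 8

/-- The parameter `B = √(1 - 4A)`. -/
def oprfB {d : ℕ} (x y : E d) : ℝ := Real.sqrt (1 - 4 * oprfA x y)

/-- The parameter `D = (1 - 4A)^{d/4}`. -/
def oprfD {d : ℕ} (x y : E d) : ℝ := (1 - 4 * oprfA x y) ^ ((d : ℝ) / 4)

/-- The generalized exponential feature `D exp (A ‖ω‖² + B ωᵀ v + C ‖v‖²)` with `s = +1`. -/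
def geFeature {d : ℕ} (A B C D : ℝ) (w v : E d) : ℝ :=
  D * Real.exp (A * ‖w‖ ^ 2 + B * inner ℝ w v + C * ‖v‖ ^ 2)

/-- The product of the two optimal positive random features at `x` and `y`, as a function of the
projection vector (`C = -1`). -/
def oprfProduct {d : ℕ} (x y w : E d) : ℝ :=
  geFeature (oprfA x y) (oprfB x y) (-1) (oprfD x y) w x *
    geFeature (oprfA x y) (oprfB x y) (-1) (oprfD x y) w y

/-- The function `g` with `oprfProduct x y ω = g (ωᵀ (x + y), ‖ω‖)`. -/
def oprfG {d : ℕ} (x y : E d) (a : ℝ) (b : ℝ≥0) : ℝ :=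
  oprfD x y ^ 2 *
    Real.exp (2 * oprfA x y * (b : ℝ) ^ 2 + oprfB x y * a - (‖x‖ ^ 2 + ‖y‖ ^ 2))

end OrthRF

end

/-! Everything reduces to one covariance. All samples have law `ν`, so both estimators have the same
diagonal variance terms. I.i.d. samples have zero covariances, so it suffices to show that two
orthogonal samples have covariance at most `-(2 / (d + 2)) * F ^ 2`.

Condition on the radii. What remains is a uniform orthonormal pair `q` and two power series in
`⟪q.1, z⟫` and `⟪q.2, z⟫` with nonnegative coefficients, so monomials suffice. The mixed moment of
degrees `k`, `l` is rotation invariant and homogeneous in `z`, hence a multiple of `‖z‖ ^ (k + l)`.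
Averaging over a Gaussian `z` finds the constant, because the two coordinates are then independent
standard normals (`IsOrthonormalPairLaw.normMoment_mul_integral`). With `N n` the `n`-th moment of
the norm of a standard Gaussian vector, and `k`, `l` even, the mixed moment is `N k * N l / N (k +
l)` times the product of the single moments. The recursion `N (n + 2) = (d + n) * N n` bounds this
ratio by `d / (d + 2) = 1 - 2 / (d + 2)` for even `k, l ≥ 2` (`normMoment_mul_le`). If a degree is
odd, the mixed moment and the product of the single moments both vanish; if a degree is zero, the
two agree. Summing the series, the gain is `2 / (d + 2)` times the product of the two means with
their constant terms removed (`IsOrthonormalPairLaw.integral_powerSeries_mul_le`).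

The radii are independent, so integrating over them factorizes both products. The mean without its
constant term becomes `E X - E g(0, ‖ω‖)`, which is `F` (`F_eq`). That lemma and the marginal law of
an orthogonal sample rest on polar decomposition: an isotropic law is determined by the law of its
norm (`IsIsotropic.eq_of_map_norm_eq`).

Positive random features are the case of an exponential series. It remains to check square
integrability and compute a Gaussian integral. For several blocks, covariances are nonpositive
within a block and zero across blocks. -/

noncomputable section

namespace OrthRF

/-! ### Moments of Gaussian coordinates -/

section

/-- The moments of the standard real Gaussian. -/
def gaussMoment (n : ℕ) : ℝ := ∫ x, x ^ n ∂(gaussianReal 0 1)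

lemma gaussMoment_zero : gaussMoment 0 = 1 := by simp [gaussMoment]

lemma gaussMoment_one : gaussMoment 1 = 0 := by simp [gaussMoment]

/-- Integration by parts against the Gaussian density `p`, using `p' = -x p`. -/
lemma gaussMoment_add_two (n : ℕ) : gaussMoment (n + 2) = (n + 1) * gaussMoment n := by
  have hint : ∀ k : ℕ, Integrable (fun x : ℝ => x ^ k * gaussianPDFReal 0 1 x) := by
    intro k
    have h := (integrable_rpow_mul_exp_neg_mul_sq (b := 1 / 2) (by norm_num) (s := k)
      (by have : (0 : ℝ) ≤ k := k.cast_nonneg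
          linarith)).const_mul ((Real.sqrt (2 * Real.pi * (1 : ℝ≥0)))⁻¹)
    refine h.congr (ae_of_all _ fun x => ?_)
    simp only [gaussianPDFReal, Real.rpow_natCast]
    ring_nf
    simp
  have hd : ∀ x : ℝ, HasDerivAt (gaussianPDFReal 0 1) (-(x * gaussianPDFReal 0 1 x)) x := by
    intro x
    have h1 : HasDerivAt (fun x : ℝ => -(x - 0) ^ 2 / (2 * ((1 : ℝ≥0) : ℝ))) (-x) x := by
      have := (((hasDerivAt_id x).sub_const 0).pow 2).neg.div_const (2 * ((1 : ℝ≥0) : ℝ))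
      refine this.congr_deriv ?_
      simp
      ring
    have h2 := h1.exp.const_mul ((Real.sqrt (2 * Real.pi * (1 : ℝ≥0)))⁻¹)
    refine h2.congr_deriv ?_
    rw [gaussianPDFReal]
    ring
  have key := integral_mul_deriv_eq_deriv_mul_of_integrable
    (u := fun x : ℝ => x ^ (n + 1)) (v := gaussianPDFReal 0 1)
    (u' := fun x : ℝ => ((n + 1 : ℕ) : ℝ) * x ^ n)
    (v' := fun x => -(x * gaussianPDFReal 0 1 x))
    (fun x _ => by simpa using hasDerivAt_pow (n + 1) x) (fun x _ => hd x)
    ((hint (n + 2)).neg.congr (ae_of_all _ fun x => by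
      simp only [Pi.mul_apply, Pi.neg_apply]; ring))
    (((hint n).const_mul ((n + 1 : ℕ) : ℝ)).congr (ae_of_all _ fun x => by
      simp only [Pi.mul_apply]; ring))
    (hint (n + 1))
  have hm : ∀ k : ℕ, gaussMoment k = ∫ x : ℝ, x ^ k * gaussianPDFReal 0 1 x := by
    intro k
    rw [gaussMoment, integral_gaussianReal_eq_integral_smul one_ne_zero]
    exact integral_congr_ae (ae_of_all _ fun x => by simp [mul_comm])
  rw [hm, hm, ← integral_const_mul]
  calc ∫ x : ℝ, x ^ (n + 2) * gaussianPDFReal 0 1 x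
      = -∫ x : ℝ, x ^ (n + 1) * -(x * gaussianPDFReal 0 1 x) := by
        rw [← integral_neg]
        exact integral_congr_ae (ae_of_all _ fun x => by simp only []; ring)
    _ = ∫ x : ℝ, ((n + 1 : ℕ) : ℝ) * x ^ n * gaussianPDFReal 0 1 x := by
        rw [key, neg_neg]
    _ = _ := integral_congr_ae (ae_of_all _ fun x => by simp only []; push_cast; ring)

lemma gaussMoment_odd {n : ℕ} (hn : Odd n) : gaussMoment n = 0 := by
  obtain ⟨k, rfl⟩ := hn
  induction k with
  | zero => exact gaussMoment_one
  | succ k ih => rw [show 2 * (k + 1) + 1 = 2 * k + 1 + 2 by ring, gaussMoment_add_two, ih, mul_zero]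

lemma gaussMoment_even_pos {n : ℕ} (hn : Even n) : 0 < gaussMoment n := by
  obtain ⟨k, rfl⟩ := hn
  induction k with
  | zero => simp [gaussMoment_zero]
  | succ k ih =>
    rw [show k + 1 + (k + 1) = k + k + 2 by ring, gaussMoment_add_two]
    positivity

variable {d : ℕ}

/-- The moments of the norm of a standard Gaussian vector. -/
def normMoment (d n : ℕ) : ℝ := ∫ w, ‖w‖ ^ n ∂(stdGaussian (E d))

lemma integrable_norm_pow_stdGaussian (d n : ℕ) :
    Integrable (fun w : E d => ‖w‖ ^ n) (stdGaussian (E d)) := by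
  simpa using (IsGaussian.memLp_id (stdGaussian (E d)) n (by simp)).integrable_norm_pow'

lemma normMoment_zero (d : ℕ) : normMoment d 0 = 1 := by simp [normMoment]

/-- Mixed moments of two coordinates of a standard Gaussian vector in an orthonormal basis. -/
lemma integral_inner_pow_mul_inner_pow_basis (b : OrthonormalBasis (Fin d) ℝ (E d))
    {i j : Fin d} (hij : i ≠ j) (k l : ℕ) :
    ∫ w, inner ℝ (b i) w ^ k * inner ℝ (b j) w ^ l ∂(stdGaussian (E d))
      = gaussMoment k * gaussMoment l := by
  rw [stdGaussian_eq_map_pi_orthonormalBasis b,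
    integral_map (Measurable.aemeasurable (by fun_prop)) (by fun_prop)]
  have h : ∀ x : Fin d → ℝ, ∀ m, inner ℝ (b m) (∑ i, x i • b i) = x m := fun x m =>
    b.orthonormal.inner_right_fintype x m
  simp only [h]
  -- Padding with factors `1` turns the monomial into a product over all coordinates, so that the
  -- integral over the product measure factorizes.
  have h2 : ∀ x : Fin d → ℝ, x i ^ k * x j ^ l
      = ∏ m, (if m = i then x m ^ k else if m = j then x m ^ l else 1) := by
    intro x
    rw [← Finset.mul_prod_erase _ _ (Finset.mem_univ i), if_pos rfl,
      ← Finset.mul_prod_erase _ _ (Finset.mem_erase.2 ⟨hij.symm, Finset.mem_univ j⟩),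
      if_neg hij.symm, if_pos rfl, Finset.prod_eq_one, mul_one]
    intro m hm
    simp only [Finset.mem_erase] at hm
    simp [hm.1, hm.2.1]
  simp only [h2]
  rw [integral_fintype_prod_eq_prod
    (f := fun m x => if m = i then x ^ k else if m = j then x ^ l else (1 : ℝ)),
    ← Finset.mul_prod_erase _ _ (Finset.mem_univ i),
    ← Finset.mul_prod_erase _ _ (Finset.mem_erase.2 ⟨hij.symm, Finset.mem_univ j⟩),
    Finset.prod_eq_one]
  · simp [hij.symm, gaussMoment]
  · intro m hm
    simp only [Finset.mem_erase] at hm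
    simp [hm.1, hm.2.1]

lemma integral_inner_pow_basis (b : OrthonormalBasis (Fin d) ℝ (E d)) (i : Fin d) (k : ℕ) :
    ∫ w, inner ℝ (b i) w ^ k ∂(stdGaussian (E d)) = gaussMoment k := by
  rw [stdGaussian_eq_map_pi_orthonormalBasis b,
    integral_map (Measurable.aemeasurable (by fun_prop)) (by fun_prop)]
  have h : ∀ x : Fin d → ℝ, ∀ m, inner ℝ (b m) (∑ i, x i • b i) = x m := fun x m =>
    b.orthonormal.inner_right_fintype x m
  simp only [h]
  rw [integral_comp_eval (μ := fun _ : Fin d => gaussianReal 0 1) (f := fun x : ℝ => x ^ k)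
    (by fun_prop)]
  rfl

/-- Mixed moments of two orthonormal directions of a standard Gaussian vector. -/
lemma integral_inner_pow_mul_inner_pow {u v : E d} (hu : ‖u‖ = 1) (hv : ‖v‖ = 1)
    (huv : inner ℝ u v = 0) (k l : ℕ) :
    ∫ w, inner ℝ u w ^ k * inner ℝ v w ^ l ∂(stdGaussian (E d))
      = gaussMoment k * gaussMoment l := by
  have ho : Orthonormal ℝ ![u, v] := by
    rw [orthonormal_iff_ite]
    intro i j
    fin_cases i <;> fin_cases j <;>
      simp [huv, real_inner_comm u v, hu, hv]
  -- Two orthonormal vectors force `2 ≤ d`, so the indices `0` and `1` exist and the pair extends to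
  -- an orthonormal basis occupying them.
  have hcard := ho.linearIndependent.fintype_card_le_finrank
  simp only [Fintype.card_fin, finrank_euclideanSpace] at hcard
  let i : Fin d := ⟨0, by omega⟩
  let j : Fin d := ⟨1, by omega⟩
  have hij : i ≠ j := by simp [i, j]
  let e : Fin d → E d := fun m => if m = i then u else v
  have he : Orthonormal ℝ (({i, j} : Set (Fin d)).domRestrict e) := by
    rw [orthonormal_iff_ite]
    rintro ⟨a, ha⟩ ⟨c, hc⟩
    simp only [Set.mem_insert_iff, Set.mem_singleton_iff] at ha hc
    rcases ha with rfl | rfl <;> rcases hc with rfl | rfl <;>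
      simp [e, hij, hij.symm, huv, real_inner_comm u v, hu, hv]
  obtain ⟨b, hb⟩ := he.exists_orthonormalBasis_extension_of_card_eq (by simp)
  have h := integral_inner_pow_mul_inner_pow_basis b hij k l
  rw [hb i (by simp), hb j (by simp)] at h
  simpa [e, hij.symm] using h

lemma integral_inner_pow {u : E d} (hu : ‖u‖ = 1) (k : ℕ) :
    ∫ w, inner ℝ u w ^ k ∂(stdGaussian (E d)) = gaussMoment k := by
  have hd : 0 < d := by
    rcases Nat.eq_zero_or_pos d with rfl | h
    · rw [Subsingleton.elim u 0, norm_zero] at hu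
      norm_num at hu
    · exact h
  let i : Fin d := ⟨0, hd⟩
  have he : Orthonormal ℝ (({i} : Set (Fin d)).domRestrict fun _ => u) := by
    rw [orthonormal_iff_ite]
    rintro ⟨a, ha⟩ ⟨c, hc⟩
    simp only [Set.mem_singleton_iff] at ha hc
    subst ha hc
    simp [hu]
  obtain ⟨b, hb⟩ := he.exists_orthonormalBasis_extension_of_card_eq (by simp)
  have h := integral_inner_pow_basis b i k
  rwa [hb i rfl] at h

end

/-! ### Moments of the Gaussian norm and of orthonormal pairs -/

section

variable {d : ℕ}

lemma exists_isometry_apply_eq {v w : E d} (h : ‖v‖ = ‖w‖) :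
    ∃ T : E d ≃ₗᵢ[ℝ] E d, T v = w :=
  ⟨_, Submodule.reflection_sub h⟩

/-- Averaging a radial homogeneous function over a standard Gaussian vector. -/
lemma norm_pow_mul_integral_of_homogeneous {Φ : E d → ℝ} {n : ℕ}
    (hT : ∀ (T : E d ≃ₗᵢ[ℝ] E d) (z : E d), Φ (T z) = Φ z)
    (hc : ∀ (c : ℝ) (z : E d), Φ (c • z) = c ^ n * Φ z) (z : E d) :
    ‖z‖ ^ n * ∫ w, Φ w ∂(stdGaussian (E d)) = normMoment d n * Φ z := by
  rw [normMoment, ← integral_const_mul, ← integral_mul_const]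
  refine integral_congr_ae (ae_of_all _ fun w => ?_)
  -- The vectors `‖z‖ • w` and `‖w‖ • z` have equal norm, so `Φ` agrees on them; homogeneity then
  -- exchanges the roles of `z` and `w`.
  obtain ⟨T, hTw⟩ := exists_isometry_apply_eq (v := ‖z‖ • w) (w := ‖w‖ • z)
    (by simp [norm_smul, mul_comm])
  simp only [← hc]
  rw [← hTw, hT]

lemma integral_inner_pow_right (w : E d) (n : ℕ) :
    ∫ z, inner ℝ w z ^ n ∂(stdGaussian (E d)) = ‖w‖ ^ n * gaussMoment n := by
  rcases eq_or_ne w 0 with rfl | hw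
  · rcases Nat.eq_zero_or_pos n with rfl | hn
    · simp [gaussMoment_zero]
    · simp [hn.ne']
  · have hu : ‖(‖w‖⁻¹ • w)‖ = 1 := by
      rw [norm_smul, norm_inv, norm_norm, inv_mul_cancel₀ (norm_ne_zero_iff.2 hw)]
    rw [← integral_inner_pow hu, ← integral_const_mul]
    refine integral_congr_ae (ae_of_all _ fun z => ?_)
    simp only [real_inner_smul_left, ← mul_pow]
    rw [← mul_assoc, mul_inv_cancel₀ (norm_ne_zero_iff.2 hw), one_mul]

/-- The double Gaussian average of `‖w‖ ^ 2 * ⟪z, w⟫ ^ n` is computed twice. Integrating `z` first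
gives `normMoment d (n + 2) * gaussMoment n`. By homogeneity it is also `normMoment d n` times the
value at a unit vector `z`, which a coordinate expansion of `‖w‖ ^ 2` evaluates. Evenness of `n`
allows division by `gaussMoment n`. -/
lemma normMoment_add_two (hd : 0 < d) {n : ℕ} (hn : Even n) :
    normMoment d (n + 2) = (d + n) * normMoment d n := by
  have key := norm_pow_mul_integral_of_homogeneous (d := d) (n := n)
    (Φ := fun z => ∫ w, ‖w‖ ^ 2 * inner ℝ z w ^ n ∂(stdGaussian (E d)))
    (fun T z => by
      conv_lhs => rw [← stdGaussian_map T]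
      rw [integral_map (by fun_prop) (by fun_prop)]
      simp)
    (fun c z => by
      rw [← integral_const_mul]
      refine integral_congr_ae (ae_of_all _ fun w => ?_)
      simp only [real_inner_smul_left]
      ring)
    ((EuclideanSpace.basisFun (Fin d) ℝ) ⟨0, hd⟩)
  have hswap : ∫ z, ∫ w, ‖w‖ ^ 2 * inner ℝ z w ^ n ∂(stdGaussian (E d)) ∂(stdGaussian (E d))
      = normMoment d (n + 2) * gaussMoment n := by
    rw [integral_integral_swap]
    · simp_rw [integral_const_mul, real_inner_comm _ _, integral_inner_pow_right, ← mul_assoc]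
      rw [integral_mul_const, normMoment]
      congr 2
      ext w
      ring
    · refine ((integrable_norm_pow_stdGaussian d n).mul_prod
        (integrable_norm_pow_stdGaussian d (n + 2))).mono' (by fun_prop) (ae_of_all _ fun q => ?_)
      simp only [Function.uncurry, norm_mul, norm_pow, norm_norm]
      calc ‖q.2‖ ^ 2 * ‖inner ℝ q.1 q.2‖ ^ n ≤ ‖q.2‖ ^ 2 * (‖q.1‖ * ‖q.2‖) ^ n := by
            gcongr
            exact norm_inner_le_norm _ _
        _ = _ := by ring
  rw [hswap] at key
  set b := EuclideanSpace.basisFun (Fin d) ℝ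
  set i : Fin d := ⟨0, hd⟩
  have hval : ∫ w, ‖w‖ ^ 2 * inner ℝ (b i) w ^ n ∂(stdGaussian (E d))
      = (d + n) * gaussMoment n := by
    have h1 : ∀ w : E d, ‖w‖ ^ 2 * inner ℝ (b i) w ^ n
        = ∑ j, inner ℝ (b j) w ^ 2 * inner ℝ (b i) w ^ n := by
      intro w
      rw [← b.sum_sq_norm_inner_right w, Finset.sum_mul]
      simp
    simp_rw [h1]
    rw [integral_finsetSum]
    -- The term `j = i` contributes `n + 1` and each of the other `d - 1` terms contributes `1`, in
    -- units of `gaussMoment n`.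
    · rw [← Finset.add_sum_erase _ _ (Finset.mem_univ i)]
      have h2 : ∫ w, inner ℝ (b i) w ^ 2 * inner ℝ (b i) w ^ n ∂(stdGaussian (E d))
          = (n + 1) * gaussMoment n := by
        rw [← gaussMoment_add_two, ← integral_inner_pow_basis b i]
        congr 1
        ext w
        ring
      have h3 : ∀ j ∈ Finset.univ.erase i,
          ∫ w, inner ℝ (b j) w ^ 2 * inner ℝ (b i) w ^ n ∂(stdGaussian (E d))
            = gaussMoment n := by
        intro j hj
        rw [integral_inner_pow_mul_inner_pow_basis b (Finset.ne_of_mem_erase hj),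
          show gaussMoment 2 = 1 by
            rw [show 2 = 0 + 2 from rfl, gaussMoment_add_two, gaussMoment_zero]; norm_num,
          one_mul]
      rw [h2, Finset.sum_congr rfl h3, Finset.sum_const, Finset.card_erase_of_mem
        (Finset.mem_univ i), Finset.card_univ, Fintype.card_fin, nsmul_eq_mul,
        Nat.cast_sub hd]
      push_cast
      ring
    · intro j _
      refine (integrable_norm_pow_stdGaussian d (2 + n)).mono' (by fun_prop)
        (ae_of_all _ fun w => ?_)
      have h4 : ∀ m, ‖inner ℝ (b m) w‖ ≤ ‖w‖ := fun m => by
        simpa using norm_inner_le_norm (𝕜 := ℝ) (b m) w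
      rw [norm_mul, norm_pow, norm_pow, pow_add]
      gcongr <;> exact h4 _
  rw [hval, b.norm_eq_one, one_pow, one_mul] at key
  have hpos := gaussMoment_even_pos hn
  refine mul_right_cancel₀ hpos.ne' ?_
  linarith

lemma normMoment_even_pos (hd : 0 < d) {n : ℕ} (hn : Even n) : 0 < normMoment d n := by
  obtain ⟨k, rfl⟩ := hn
  induction k with
  | zero => simp [normMoment_zero]
  | succ k ih =>
    rw [show k + 1 + (k + 1) = k + k + 2 by ring, normMoment_add_two hd ⟨k, rfl⟩]
    positivity

/-- Source of the constant `2 / (d + 2)`. Raising `m` by two multiplies the left side by `d + m` and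
the right side by the larger `d + m + n`, so the case `m = 2` decides; there the claim is `d + 2 ≤ d
+ n`, with equality at `n = 2`. -/
lemma normMoment_mul_le (hd : 0 < d) {m n : ℕ} (hm : Even m) (hn : Even n) (hm0 : m ≠ 0)
    (hn0 : n ≠ 0) :
    (d + 2) * (normMoment d m * normMoment d n) ≤ d * normMoment d (m + n) := by
  obtain ⟨k, rfl⟩ := hm
  obtain ⟨k, rfl⟩ : ∃ j, k = j + 1 := ⟨k - 1, by omega⟩
  have hn2 : (2 : ℝ) ≤ n := by
    obtain ⟨l, rfl⟩ := hn
    push_cast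
    have : (1 : ℝ) ≤ l := by exact_mod_cast (by omega : 1 ≤ l)
    linarith
  induction k with
  | zero =>
    rw [show 0 + 1 + (0 + 1) + n = n + 2 by ring, show 0 + 1 + (0 + 1) = 0 + 2 from rfl,
      normMoment_add_two hd Even.zero, normMoment_add_two hd hn, normMoment_zero]
    have h1 := normMoment_even_pos hd hn
    have h2 : 0 ≤ (d : ℝ) * normMoment d n * (n - 2) := by
      have : (0 : ℝ) ≤ n - 2 := by linarith
      positivity
    push_cast
    linarith
  | succ k ih =>
    have ih := ih (by omega)
    have he : Even (k + 1 + (k + 1)) := ⟨_, rfl⟩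
    rw [show k + 1 + 1 + (k + 1 + 1) + n = k + 1 + (k + 1) + n + 2 by ring,
      show k + 1 + 1 + (k + 1 + 1) = k + 1 + (k + 1) + 2 by ring,
      normMoment_add_two hd he, normMoment_add_two hd (he.add hn)]
    have h1 := normMoment_even_pos hd (he.add hn)
    set a := k + 1 + (k + 1)
    calc (d + 2 : ℝ) * ((d + a) * normMoment d a * normMoment d n)
        = (d + a) * ((d + 2) * (normMoment d a * normMoment d n)) := by ring
      _ ≤ (d + a) * (d * normMoment d (a + n)) := by gcongr
      _ ≤ (d + (a + n : ℕ)) * (d * normMoment d (a + n)) := by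
          gcongr
          omega
      _ = _ := by ring

/-- A probability law of pairs of orthonormal vectors, invariant under all linear isometries. -/
structure IsOrthonormalPairLaw (π : Measure (E d × E d)) : Prop where
  isProbabilityMeasure : IsProbabilityMeasure π
  map_eq : ∀ T : E d ≃ₗᵢ[ℝ] E d, π.map (Prod.map T T) = π
  orthonormal : ∀ᵐ q ∂π, ‖q.1‖ = 1 ∧ ‖q.2‖ = 1 ∧ inner ℝ q.1 q.2 = 0

namespace IsOrthonormalPairLaw

variable {π : Measure (E d × E d)}

lemma dim_pos (hπ : IsOrthonormalPairLaw π) : 0 < d := by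
  have := hπ.isProbabilityMeasure
  obtain ⟨q, hq, -⟩ := hπ.orthonormal.exists
  rcases Nat.eq_zero_or_pos d with rfl | h
  · rw [Subsingleton.elim q.1 0, norm_zero] at hq
    norm_num at hq
  · exact h

lemma abs_inner_le (hπ : IsOrthonormalPairLaw π) (z : E d) :
    ∀ᵐ q ∂π, |inner ℝ q.1 z| ≤ ‖z‖ ∧ |inner ℝ q.2 z| ≤ ‖z‖ := by
  filter_upwards [hπ.orthonormal] with q hq
  have h1 := abs_real_inner_le_norm q.1 z
  have h2 := abs_real_inner_le_norm q.2 z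
  rw [hq.1, one_mul] at h1
  rw [hq.2.1, one_mul] at h2
  exact ⟨h1, h2⟩

/-- The mixed moments of the coordinates of an orthonormal pair. -/
lemma normMoment_mul_integral (hπ : IsOrthonormalPairLaw π) (z : E d) (k l : ℕ) :
    normMoment d (k + l) * ∫ q, inner ℝ q.1 z ^ k * inner ℝ q.2 z ^ l ∂π
      = ‖z‖ ^ (k + l) * (gaussMoment k * gaussMoment l) := by
  have := hπ.isProbabilityMeasure
  -- The mixed moment, as a function of `z`, is invariant and homogeneous of degree `k + l`. After
  -- swapping integrals, the inner average over Gaussian `z` for a fixed orthonormal pair is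
  -- `gaussMoment k * gaussMoment l`.
  rw [← norm_pow_mul_integral_of_homogeneous (d := d) (n := k + l)
    (Φ := fun z => ∫ q, inner ℝ q.1 z ^ k * inner ℝ q.2 z ^ l ∂π)]
  · rw [integral_integral_swap]
    · congr 1
      calc _ = ∫ q, gaussMoment k * gaussMoment l ∂π := by
            refine integral_congr_ae ?_
            filter_upwards [hπ.orthonormal] with q hq
            exact integral_inner_pow_mul_inner_pow hq.1 hq.2.1 hq.2.2 k l
        _ = _ := by simp
    · refine ((integrable_norm_pow_stdGaussian d (k + l)).mul_prod
        (integrable_const (1 : ℝ) (μ := π))).mono' (by fun_prop) ?_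
      have h : ∀ᵐ x ∂(stdGaussian (E d)).prod π, ‖x.2.1‖ = 1 ∧ ‖x.2.2‖ = 1 := by
        have := Measure.quasiMeasurePreserving_snd (μ := stdGaussian (E d)) (ν := π)
        filter_upwards [this.ae hπ.orthonormal] with x hx
        exact ⟨hx.1, hx.2.1⟩
      filter_upwards [h] with x hx
      simp only [Function.uncurry, norm_mul, norm_pow, mul_one]
      rw [pow_add]
      have h1 := norm_inner_le_norm (𝕜 := ℝ) x.2.1 x.1
      have h2 := norm_inner_le_norm (𝕜 := ℝ) x.2.2 x.1
      rw [hx.1, one_mul] at h1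
      rw [hx.2, one_mul] at h2
      gcongr
  · intro T z
    conv_lhs => rw [← hπ.map_eq T]
    rw [integral_map (Measurable.aemeasurable (by fun_prop)) (by fun_prop)]
    simp
  · intro c z
    rw [← integral_const_mul]
    refine integral_congr_ae (ae_of_all _ fun w => ?_)
    simp only [real_inner_smul_right]
    ring

lemma moment_left (hπ : IsOrthonormalPairLaw π) (z : E d) (k : ℕ) :
    normMoment d k * ∫ q, inner ℝ q.1 z ^ k ∂π = ‖z‖ ^ k * gaussMoment k := by
  simpa [gaussMoment_zero] using hπ.normMoment_mul_integral z k 0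

lemma moment_right (hπ : IsOrthonormalPairLaw π) (z : E d) (k : ℕ) :
    normMoment d k * ∫ q, inner ℝ q.2 z ^ k ∂π = ‖z‖ ^ k * gaussMoment k := by
  simpa [gaussMoment_zero] using hπ.normMoment_mul_integral z 0 k

end IsOrthonormalPairLaw

end

/-! ### Negative correlation of power series in orthonormal directions -/

section

section PowerSeries

variable {α : Type*} [MeasurableSpace α] {P : Measure α} [IsProbabilityMeasure P]
  {φ ψ : ℝ → ℝ} {a b : ℕ → ℝ} {X Y : α → ℝ} {R : ℝ}

/-- Boundedness by `R` dominates the terms by `a k * R ^ k * (b l * R ^ l)`. With nonnegative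
coefficients this is summable because both series converge at `R`, which justifies the interchange.
-/
lemma hasSum_integral_mul_pow_mul_pow (ha : ∀ k, 0 ≤ a k) (hb : ∀ k, 0 ≤ b k)
    (hφ : ∀ x, HasSum (fun k => a k * x ^ k) (φ x))
    (hψ : ∀ x, HasSum (fun k => b k * x ^ k) (ψ x))
    (hX : AEStronglyMeasurable X P) (hY : AEStronglyMeasurable Y P)
    (hR : ∀ᵐ p ∂P, |X p| ≤ R ∧ |Y p| ≤ R) :
    HasSum (fun n : ℕ × ℕ => a n.1 * b n.2 * ∫ p, X p ^ n.1 * Y p ^ n.2 ∂P)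
      (∫ p, φ (X p) * ψ (Y p) ∂P) := by
  obtain ⟨p₀, hp₀⟩ := hR.exists
  have hR0 : 0 ≤ R := (abs_nonneg _).trans hp₀.1
  have hbound : ∀ n : ℕ × ℕ, ∀ᵐ p ∂P, ‖a n.1 * b n.2 * (X p ^ n.1 * Y p ^ n.2)‖
      ≤ (a n.1 * R ^ n.1) * (b n.2 * R ^ n.2) := by
    intro n
    filter_upwards [hR] with p hp
    have h1 := hp.1
    have h2 := hp.2
    have := ha n.1
    have := hb n.2
    rw [Real.norm_eq_abs, abs_mul, abs_mul, abs_mul, abs_pow, abs_pow, abs_of_nonneg (ha _),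
      abs_of_nonneg (hb _)]
    calc a n.1 * b n.2 * (|X p| ^ n.1 * |Y p| ^ n.2)
        ≤ a n.1 * b n.2 * (R ^ n.1 * R ^ n.2) := by gcongr
      _ = _ := by ring
  have hint : ∀ n : ℕ × ℕ, Integrable (fun p => a n.1 * b n.2 * (X p ^ n.1 * Y p ^ n.2)) P :=
    fun n => (integrable_const _).mono' (by fun_prop) (hbound n)
  have hsum : Summable fun n : ℕ × ℕ => (a n.1 * R ^ n.1) * (b n.2 * R ^ n.2) :=
    Summable.mul_of_nonneg (f := fun k => a k * R ^ k) (g := fun k => b k * R ^ k)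
      (hφ R).summable (hψ R).summable
      (fun k => mul_nonneg (ha k) (pow_nonneg hR0 k)) (fun k => mul_nonneg (hb k) (pow_nonneg hR0 k))
  have key := hasSum_integral_of_summable_integral_norm hint
    (hsum.of_nonneg_of_le (fun n => integral_nonneg fun p => norm_nonneg _) fun n => by
      simpa using integral_mono_ae (hint n).norm (integrable_const _) (hbound n))
  simp only [integral_const_mul] at key
  have htsum : ∀ p, ∑' n : ℕ × ℕ, a n.1 * b n.2 * (X p ^ n.1 * Y p ^ n.2)
      = φ (X p) * ψ (Y p) := by
    intro p
    have h1 := hφ (X p)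
    have h2 := hψ (Y p)
    have h3 := summable_mul_of_summable_norm (f := fun k => a k * X p ^ k)
      (g := fun k => b k * Y p ^ k) h1.summable.norm h2.summable.norm
    rw [← (h1.mul h2 h3).tsum_eq]
    exact tsum_congr fun n => by ring
  rwa [integral_congr_ae (ae_of_all P htsum)] at key

lemma hasSum_integral_mul_pow (ha : ∀ k, 0 ≤ a k)
    (hφ : ∀ x, HasSum (fun k => a k * x ^ k) (φ x))
    (hX : AEStronglyMeasurable X P) (hR : ∀ᵐ p ∂P, |X p| ≤ R) :
    HasSum (fun k => a k * ∫ p, X p ^ k ∂P) (∫ p, φ (X p) ∂P) := by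
  obtain ⟨p₀, hp₀⟩ := hR.exists
  have hbound : ∀ k : ℕ, ∀ᵐ p ∂P, ‖a k * X p ^ k‖ ≤ a k * R ^ k := by
    intro k
    filter_upwards [hR] with p hp
    have := ha k
    rw [Real.norm_eq_abs, abs_mul, abs_pow, abs_of_nonneg (ha _)]
    gcongr
  have hint : ∀ k : ℕ, Integrable (fun p => a k * X p ^ k) P :=
    fun k => (integrable_const _).mono' (by fun_prop) (hbound k)
  have key := hasSum_integral_of_summable_integral_norm hint
    ((hφ R).summable.of_nonneg_of_le (fun n => integral_nonneg fun p => norm_nonneg _) fun n => by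
      simpa using integral_mono_ae (hint n).norm (integrable_const _) (hbound n))
  simp only [integral_const_mul] at key
  rwa [integral_congr_ae (ae_of_all P fun p => (hφ (X p)).tsum_eq)] at key

lemma eq_coeff_zero_of_hasSum (hφ : ∀ x, HasSum (fun k => a k * x ^ k) (φ x)) :
    φ 0 = a 0 := by
  refine (hφ 0).unique ?_
  convert hasSum_single (f := fun k => a k * (0 : ℝ) ^ k) 0 (fun k hk => by simp [hk]) using 1
  simp

end PowerSeries

namespace IsOrthonormalPairLaw

variable {d : ℕ} {π : Measure (E d × E d)}

/-- The isometry `-1` preserves the law and flips the sign of the integrand. -/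
lemma integral_eq_zero_of_odd (hπ : IsOrthonormalPairLaw π) (z : E d) {k l : ℕ}
    (h : Odd (k + l)) : ∫ q, inner ℝ q.1 z ^ k * inner ℝ q.2 z ^ l ∂π = 0 := by
  have h1 : ∫ q, inner ℝ q.1 z ^ k * inner ℝ q.2 z ^ l ∂π
      = -∫ q, inner ℝ q.1 z ^ k * inner ℝ q.2 z ^ l ∂π := by
    conv_lhs => rw [← hπ.map_eq (LinearIsometryEquiv.neg ℝ)]
    rw [integral_map (Measurable.aemeasurable (by fun_prop)) (by fun_prop), ← integral_neg]
    refine integral_congr_ae (ae_of_all _ fun q => ?_)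
    simp only [Prod.map_fst, Prod.map_snd, LinearIsometryEquiv.coe_neg, inner_neg_left]
    rw [neg_pow, neg_pow (inner ℝ q.2 z), mul_mul_mul_comm, ← pow_add, h.neg_one_pow]
    ring
  linarith

lemma moment_left_of_odd (hπ : IsOrthonormalPairLaw π) (z : E d) {k : ℕ} (h : Odd k) :
    ∫ q, inner ℝ q.1 z ^ k ∂π = 0 := by
  simpa using hπ.integral_eq_zero_of_odd z (k := k) (l := 0) h

lemma moment_right_of_odd (hπ : IsOrthonormalPairLaw π) (z : E d) {k : ℕ} (h : Odd k) :
    ∫ q, inner ℝ q.2 z ^ k ∂π = 0 := by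
  simpa using hπ.integral_eq_zero_of_odd z (k := 0) (l := k) (by simpa using h)

lemma moment_left_nonneg (hπ : IsOrthonormalPairLaw π) (z : E d) (k : ℕ) :
    0 ≤ ∫ q, inner ℝ q.1 z ^ k ∂π := by
  rcases k.even_or_odd with h | h
  · exact integral_nonneg fun q => h.pow_nonneg _
  · exact (hπ.moment_left_of_odd z h).ge

lemma moment_right_nonneg (hπ : IsOrthonormalPairLaw π) (z : E d) (k : ℕ) :
    0 ≤ ∫ q, inner ℝ q.2 z ^ k ∂π := by
  rcases k.even_or_odd with h | h
  · exact integral_nonneg fun q => h.pow_nonneg _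
  · exact (hπ.moment_right_of_odd z h).ge

/-- Powers of the coordinates of an orthonormal pair are negatively correlated. -/
lemma integral_pow_mul_pow_le (hπ : IsOrthonormalPairLaw π) (z : E d) (k l : ℕ) :
    ∫ q, inner ℝ q.1 z ^ k * inner ℝ q.2 z ^ l ∂π
      ≤ (∫ q, inner ℝ q.1 z ^ k ∂π) * (∫ q, inner ℝ q.2 z ^ l ∂π)
        - 2 / ((d : ℝ) + 2) * ((if k = 0 then 0 else ∫ q, inner ℝ q.1 z ^ k ∂π)
          * (if l = 0 then 0 else ∫ q, inner ℝ q.2 z ^ l ∂π)) := by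
  have := hπ.isProbabilityMeasure
  rcases eq_or_ne k 0 with rfl | hk
  · simp
  rcases eq_or_ne l 0 with rfl | hl
  · simp
  rw [if_neg hk, if_neg hl]
  have hd := hπ.dim_pos
  rcases k.even_or_odd with hke | hko
  · rcases l.even_or_odd with hle | hlo
    · have h0 := hπ.normMoment_mul_integral z k l
      have h1 := hπ.moment_left z k
      have h2 := hπ.moment_right z l
      have hN := normMoment_mul_le hd hke hle hk hl
      have p0 := normMoment_even_pos hd (hke.add hle)
      have p1 := hπ.moment_left_nonneg z k
      have p2 := hπ.moment_right_nonneg z l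
      set c := ∫ q, inner ℝ q.1 z ^ k * inner ℝ q.2 z ^ l ∂π
      set m := ∫ q, inner ℝ q.1 z ^ k ∂π
      set n := ∫ q, inner ℝ q.2 z ^ l ∂π
      -- Both sides equal `‖z‖ ^ (k + l) * (gaussMoment k * gaussMoment l)`.
      have h3 : normMoment d (k + l) * c
          = normMoment d k * normMoment d l * (m * n) := by
        rw [h0, pow_add]
        linear_combination (-(normMoment d l * n)) * h1 - (‖z‖ ^ k * gaussMoment k) * h2
      have hd2 : (0 : ℝ) < d + 2 := by positivity
      have h4 : (d + 2 : ℝ) * c ≤ d * (m * n) := by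
        refine le_of_mul_le_mul_left ?_ p0
        calc normMoment d (k + l) * ((d + 2) * c)
            = (d + 2) * (normMoment d k * normMoment d l) * (m * n) := by
              linear_combination (d + 2 : ℝ) * h3
          _ ≤ d * normMoment d (k + l) * (m * n) := by gcongr
          _ = _ := by ring
      refine le_of_mul_le_mul_left ?_ hd2
      calc (d + 2 : ℝ) * c ≤ d * (m * n) := h4
        _ = _ := by field_simp; ring
    · rw [hπ.integral_eq_zero_of_odd z (hke.add_odd hlo), hπ.moment_right_of_odd z hlo]
      simp
  · have hc : ∫ q, inner ℝ q.1 z ^ k * inner ℝ q.2 z ^ l ∂π = 0 := by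
      rcases l.even_or_odd with hle | hlo
      · exact hπ.integral_eq_zero_of_odd z (hko.add_even hle)
      -- For `k`, `l` both odd the total degree is even and the symmetry `-1` says nothing; the
      -- moment formula applies instead, its right side vanishing with `gaussMoment k`.
      · have h0 := hπ.normMoment_mul_integral z k l
        rw [gaussMoment_odd hko, zero_mul, mul_zero] at h0
        exact (mul_eq_zero.1 h0).resolve_left (normMoment_even_pos hd (hko.add_odd hlo)).ne'
    rw [hc, hπ.moment_left_of_odd z hko]
    simp

/-- Power series with nonnegative coefficients in the coordinates of an orthonormal pair are
negatively correlated, with a quantitative gain. -/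
lemma integral_powerSeries_mul_le (hπ : IsOrthonormalPairLaw π) (z : E d)
    {φ ψ : ℝ → ℝ} {a b : ℕ → ℝ} (ha : ∀ k, 0 ≤ a k) (hb : ∀ k, 0 ≤ b k)
    (hφ : ∀ x, HasSum (fun k => a k * x ^ k) (φ x))
    (hψ : ∀ x, HasSum (fun k => b k * x ^ k) (ψ x)) :
    ∫ q, φ (inner ℝ q.1 z) * ψ (inner ℝ q.2 z) ∂π
      ≤ (∫ q, φ (inner ℝ q.1 z) ∂π) * (∫ q, ψ (inner ℝ q.2 z) ∂π)
        - 2 / ((d : ℝ) + 2) * (((∫ q, φ (inner ℝ q.1 z) ∂π) - φ 0)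
          * ((∫ q, ψ (inner ℝ q.2 z) ∂π) - ψ 0)) := by
  have := hπ.isProbabilityMeasure
  have hR := hπ.abs_inner_le z
  have h0 := hasSum_integral_mul_pow_mul_pow ha hb hφ hψ (P := π)
    (X := fun q => inner ℝ q.1 z) (Y := fun q => inner ℝ q.2 z) (by fun_prop) (by fun_prop) hR
  have h1 := hasSum_integral_mul_pow ha hφ (P := π)
    (X := fun q => inner ℝ q.1 z) (by fun_prop) (hR.mono fun q h => h.1)
  have h2 := hasSum_integral_mul_pow hb hψ (P := π)
    (X := fun q => inner ℝ q.2 z) (by fun_prop) (hR.mono fun q h => h.2)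
  have n1 : ∀ k, 0 ≤ a k * ∫ q, inner ℝ q.1 z ^ k ∂π :=
    fun k => mul_nonneg (ha k) (hπ.moment_left_nonneg z k)
  have n2 : ∀ k, 0 ≤ b k * ∫ q, inner ℝ q.2 z ^ k ∂π :=
    fun k => mul_nonneg (hb k) (hπ.moment_right_nonneg z k)
  -- Removing the degree-zero term `a 0 = φ 0` leaves the series of degrees that contribute to the
  -- gain.
  have h1' := h1.sub (hasSum_ite_eq 0 (φ 0))
  have h2' := h2.sub (hasSum_ite_eq 0 (ψ 0))
  have e1 : ∀ k, (a k * ∫ q, inner ℝ q.1 z ^ k ∂π) - (if k = 0 then φ 0 else 0)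
      = a k * (if k = 0 then 0 else ∫ q, inner ℝ q.1 z ^ k ∂π) := by
    intro k
    rcases eq_or_ne k 0 with rfl | hk
    · simp [eq_coeff_zero_of_hasSum hφ]
    · simp [hk]
  have e2 : ∀ k, (b k * ∫ q, inner ℝ q.2 z ^ k ∂π) - (if k = 0 then ψ 0 else 0)
      = b k * (if k = 0 then 0 else ∫ q, inner ℝ q.2 z ^ k ∂π) := by
    intro k
    rcases eq_or_ne k 0 with rfl | hk
    · simp [eq_coeff_zero_of_hasSum hψ]
    · simp [hk]
  simp only [e1] at h1'
  simp only [e2] at h2'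
  have n1' : ∀ k, 0 ≤ a k * (if k = 0 then 0 else ∫ q, inner ℝ q.1 z ^ k ∂π) := by
    intro k
    split_ifs
    · simp
    · exact n1 k
  have n2' : ∀ k, 0 ≤ b k * (if k = 0 then 0 else ∫ q, inner ℝ q.2 z ^ k ∂π) := by
    intro k
    split_ifs
    · simp
    · exact n2 k
  have h3 := h1.mul h2 (h1.summable.mul_of_nonneg h2.summable n1 n2)
  have h4 := (h1'.mul h2' (h1'.summable.mul_of_nonneg h2'.summable n1' n2')).mul_left
    (2 / ((d : ℝ) + 2))
  refine hasSum_le (fun n => ?_) h0 (h3.sub h4)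
  have h5 := mul_le_mul_of_nonneg_left (hπ.integral_pow_mul_pow_le z n.1 n.2)
    (mul_nonneg (ha n.1) (hb n.2))
  refine h5.trans_eq ?_
  ring

end IsOrthonormalPairLaw

end

/-! ### Isotropic laws, polar decomposition and the reduction term -/

section

open scoped Pointwise in
-- The surface measure of a set is, up to a constant, the volume of the cone `(0, 1) • s`;
-- isometries commute with forming cones and preserve volume.
lemma toSphere_preimage_isometry {d : ℕ} (T : E d ≃ₗᵢ[ℝ] E d) {s : Set (E d)}
    (hs : MeasurableSet s) :
    (volume : Measure (E d)).toSphere ((↑) ⁻¹' (T ⁻¹' s))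
      = (volume : Measure (E d)).toSphere ((↑) ⁻¹' s) := by
  rw [Measure.toSphere_apply' _ (measurable_subtype_coe (T.continuous.measurable hs)),
    Measure.toSphere_apply' _ (measurable_subtype_coe hs)]
  congr 1
  have h : Set.Ioo (0 : ℝ) 1 • ((↑) '' ((↑) ⁻¹' (T ⁻¹' s) : Set (Metric.sphere (0 : E d) 1)))
      = T ⁻¹' (Set.Ioo (0 : ℝ) 1 • ((↑) '' ((↑) ⁻¹' s : Set (Metric.sphere (0 : E d) 1)))) := by
    ext x
    simp only [Set.mem_smul, Set.mem_preimage, Subtype.image_preimage_coe, Set.mem_inter_iff,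
      mem_sphere_zero_iff_norm]
    constructor
    · rintro ⟨c, hc, y, ⟨hy, hys⟩, rfl⟩
      exact ⟨c, hc, T y, ⟨by simpa using hy, hys⟩, by simp⟩
    · rintro ⟨c, hc, y, ⟨hy, hys⟩, hyx⟩
      refine ⟨c, hc, T.symm y, ⟨by simpa using hy, by simpa using hys⟩, ?_⟩
      rw [← map_smul, hyx, LinearIsometryEquiv.symm_apply_apply]
  rw [h]
  exact T.measurePreserving.measure_preimage_equiv (f := T.toMeasurableEquiv) _

variable {d : ℕ}

lemma isProbabilityMeasure_unifSphere (hd : 0 < d) : IsProbabilityMeasure (unifSphere d) := by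
  have : Nonempty (Fin d) := ⟨⟨0, hd⟩⟩
  have : NeZero (volume : Measure (E d)).toSphere := ⟨Measure.toSphere_ne_zero _⟩
  exact isProbabilityMeasureSMul

/-- The uniform law on the unit sphere, as a measure on the whole space. -/
def sphereLaw (d : ℕ) : Measure (E d) := (unifSphere d).map (↑)

lemma isProbabilityMeasure_sphereLaw (hd : 0 < d) : IsProbabilityMeasure (sphereLaw d) := by
  have := isProbabilityMeasure_unifSphere hd
  exact Measure.isProbabilityMeasure_map (Measurable.aemeasurable (by fun_prop))

lemma isIsotropic_sphereLaw : IsIsotropic (sphereLaw d) := by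
  intro T
  ext s hs
  have hT : Measurable T := T.continuous.measurable
  rw [Measure.map_apply hT hs, sphereLaw, Measure.map_apply (by fun_prop) (hT hs),
    Measure.map_apply (by fun_prop) hs, unifSphere, Measure.smul_apply, Measure.smul_apply,
    toSphere_preimage_isometry T hs]

lemma ae_norm_eq_one_sphereLaw : ∀ᵐ u ∂(sphereLaw d), ‖u‖ = 1 := by
  rw [sphereLaw, ae_map_iff (by fun_prop) (measurableSet_eq_fun (by fun_prop) (by fun_prop))]
  exact ae_of_all _ fun u => by simp

lemma IsIsotropic.charFun_eq {ν : Measure (E d)} (hν : IsIsotropic ν) {x y : E d}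
    (h : ‖x‖ = ‖y‖) : charFun ν x = charFun ν y := by
  obtain ⟨T, rfl⟩ := exists_isometry_apply_eq h
  conv_rhs => rw [← hν T]
  rw [charFun_apply, charFun_apply, integral_map (by fun_prop) (by fun_prop)]
  simp

/-- The characteristic function of an isotropic law in terms of the law of its norm. -/
lemma IsIsotropic.charFun_eq_integral_norm (hd : 0 < d) {ν : Measure (E d)}
    [IsProbabilityMeasure ν] (hν : IsIsotropic ν) {e : E d} (he : ‖e‖ = 1) (z : E d) :
    charFun ν z = ∫ t, charFun (sphereLaw d) ((‖z‖ * t) • e) ∂(ν.map (fun w => ‖w‖)) := by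
  have := isProbabilityMeasure_sphereLaw hd
  rw [integral_map (by fun_prop) (by fun_prop)]
  -- The characteristic function is constant on the sphere of radius `‖z‖`, so it may be averaged
  -- over that sphere. After Fubini the inner integral is the characteristic function of `sphereLaw
  -- d` at `‖z‖ • w`, which depends on `w` only through `‖w‖`.
  calc charFun ν z = ∫ v, charFun ν z ∂(sphereLaw d) := by simp
    _ = ∫ v, ∫ w, Complex.exp ((inner ℝ w (‖z‖ • v) : ℝ) * Complex.I) ∂ν ∂(sphereLaw d) := by
        refine integral_congr_ae ?_
        filter_upwards [ae_norm_eq_one_sphereLaw] with v hv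
        rw [← charFun_apply]
        exact hν.charFun_eq (by simp [norm_smul, hv])
    _ = ∫ w, ∫ v, Complex.exp ((inner ℝ w (‖z‖ • v) : ℝ) * Complex.I) ∂(sphereLaw d) ∂ν := by
        rw [integral_integral_swap]
        refine (integrable_const (1 : ℝ)).mono' (by fun_prop) (ae_of_all _ fun q => ?_)
        simp [Function.uncurry, Complex.norm_exp_ofReal_mul_I]
    _ = ∫ w, charFun (sphereLaw d) (‖z‖ • w) ∂ν := by
        refine integral_congr_ae (ae_of_all _ fun w => ?_)
        simp only [charFun_apply]
        congr 1
        ext v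
        rw [real_inner_smul_right, real_inner_smul_right, real_inner_comm]
    _ = _ := by
        refine integral_congr_ae (ae_of_all _ fun w => ?_)
        refine isIsotropic_sphereLaw.charFun_eq ?_
        simp [norm_smul, he]

/-- An isotropic law is determined by the law of its norm. -/
lemma IsIsotropic.eq_of_map_norm_eq {ν ν' : Measure (E d)} (hd : 0 < d)
    [IsProbabilityMeasure ν] [IsProbabilityMeasure ν'] (hν : IsIsotropic ν)
    (hν' : IsIsotropic ν')
    (h : ν.map (fun w => ‖w‖) = ν'.map (fun w => ‖w‖)) : ν = ν' := by
  refine Measure.ext_of_charFun (funext fun z => ?_)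
  have he : ‖(EuclideanSpace.basisFun (Fin d) ℝ) ⟨0, hd⟩‖ = 1 :=
    (EuclideanSpace.basisFun (Fin d) ℝ).norm_eq_one _
  rw [hν.charFun_eq_integral_norm hd he, hν'.charFun_eq_integral_norm hd he, h]

/-- Polar decomposition of an isotropic law. -/
lemma IsIsotropic.map_smul_prod {ν σ : Measure (E d)} (hd : 0 < d)
    [IsProbabilityMeasure ν] [IsProbabilityMeasure σ] (hν : IsIsotropic ν)
    (hσ : IsIsotropic σ) (hσ1 : ∀ᵐ u ∂σ, ‖u‖ = 1) :
    ((ν.map (fun w => ‖w‖)).prod σ).map (fun q => q.1 • q.2) = ν := by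
  have : IsProbabilityMeasure (ν.map (fun w => ‖w‖)) :=
    Measure.isProbabilityMeasure_map (by fun_prop)
  have : IsProbabilityMeasure (((ν.map (fun w => ‖w‖)).prod σ).map (fun q => q.1 • q.2)) :=
    Measure.isProbabilityMeasure_map (Measurable.aemeasurable (by fun_prop))
  -- It suffices that the product law is isotropic, since isometries commute with scaling and
  -- preserve `σ`, and that its norm is almost surely the radius.
  refine IsIsotropic.eq_of_map_norm_eq hd ?_ hν ?_
  · intro T
    have hT : Measurable T := T.continuous.measurable
    rw [Measure.map_map hT (by fun_prop)]
    conv_rhs => rw [← hσ T, ← Measure.map_id (μ := ν.map (fun w => ‖w‖)),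
      Measure.map_prod_map _ _ measurable_id hT,
      Measure.map_map (by fun_prop) (by fun_prop)]
    congr 1
    ext q : 1
    simp
  · rw [Measure.map_map (by fun_prop) (by fun_prop)]
    have h : ((fun w : E d => ‖w‖) ∘ fun q : ℝ × E d => q.1 • q.2)
        =ᵐ[(ν.map (fun w => ‖w‖)).prod σ] Prod.fst := by
      have h1 := (Measure.quasiMeasurePreserving_snd
        (μ := ν.map (fun w => ‖w‖)) (ν := σ)).ae hσ1
      have h2 : ∀ᵐ t ∂(ν.map (fun w => ‖w‖)), 0 ≤ t := by
        rw [ae_map_iff (by fun_prop) measurableSet_Ici]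
        exact ae_of_all _ fun w => norm_nonneg w
      have h3 := (Measure.quasiMeasurePreserving_fst
        (μ := ν.map (fun w => ‖w‖)) (ν := σ)).ae h2
      filter_upwards [h1, h3] with q hq1 hq2
      simp [norm_smul, hq1, abs_of_nonneg hq2]
    rw [Measure.map_congr h, Measure.map_fst_prod]
    simp

/-- Polar decomposition of an isotropic law, with the uniform distribution on the sphere. -/
lemma IsIsotropic.map_smul_unifSphere {ν : Measure (E d)} (hd : 0 < d)
    [IsProbabilityMeasure ν] (hν : IsIsotropic ν) :
    ((unifSphere d).prod (ν.map (fun w => ‖w‖₊))).map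
      (fun q => (q.2 : ℝ) • (q.1 : E d)) = ν := by
  have := isProbabilityMeasure_unifSphere hd
  have := isProbabilityMeasure_sphereLaw hd
  have : IsProbabilityMeasure (ν.map (fun w => ‖w‖₊)) :=
    Measure.isProbabilityMeasure_map (by fun_prop)
  conv_rhs => rw [← hν.map_smul_prod hd isIsotropic_sphereLaw ae_norm_eq_one_sphereLaw]
  have h : ν.map (fun w => ‖w‖) = (ν.map (fun w => ‖w‖₊)).map ((↑) : ℝ≥0 → ℝ) := by
    rw [Measure.map_map (by fun_prop) (by fun_prop)]
    rfl
  rw [h, sphereLaw, Measure.map_prod_map _ _ (by fun_prop) (by fun_prop),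
    Measure.map_map (by fun_prop) (by fun_prop), ← Measure.prod_swap,
    Measure.map_map (by fun_prop) (by fun_prop)]
  rfl

lemma IsIsotropic.integral_comp {ν : Measure (E d)} (hν : IsIsotropic ν)
    (T : E d ≃ₗᵢ[ℝ] E d) (f : E d → ℝ) : ∫ w, f (T w) ∂ν = ∫ w, f w ∂ν := by
  conv_rhs => rw [← hν T]
  exact (integral_map_equiv T.toMeasurableEquiv f).symm

lemma IsIsotropic.integrable_comp {ν : Measure (E d)} (hν : IsIsotropic ν)
    (T : E d ≃ₗᵢ[ℝ] E d) {f : E d → ℝ} (hf : Integrable f ν) :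
    Integrable (fun w => f (T w)) ν := by
  rw [← hν T] at hf
  exact hf.comp_measurable T.continuous.measurable

lemma isIsotropic_stdGaussian : IsIsotropic (stdGaussian (E d)) := fun T => stdGaussian_map T

section SampleValue

variable {g : ℝ → ℝ≥0 → ℝ} {z : E d} {ν : Measure (E d)}

lemma measurable_sampleValue (hg : Measurable (Function.uncurry g)) (z : E d) :
    Measurable (sampleValue g z) :=
  hg.comp (g := Function.uncurry g) (f := fun w => (inner ℝ w z, ‖w‖₊)) (by fun_prop)

lemma HasNonnegCoeffs.zero_nonneg (h : HasNonnegCoeffs g) (y : ℝ≥0) : 0 ≤ g 0 y := by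
  obtain ⟨a, ha, hs⟩ := h y
  rw [eq_coeff_zero_of_hasSum hs]
  exact ha 0

/-- Only the terms of even degree at least two survive, and each is nonnegative. -/
lemma HasNonnegCoeffs.gTilde_nonneg (h : HasNonnegCoeffs g) (x : ℝ) (y : ℝ≥0) :
    0 ≤ gTilde g x y := by
  obtain ⟨a, ha, hs⟩ := h y
  have h1 := (((hs x).add (hs (-x))).div_const 2).sub (hs 0)
  refine h1.nonneg fun k => ?_
  rcases eq_or_ne k 0 with rfl | hk
  · simp
  · rw [zero_pow hk, mul_zero, sub_zero, ← mul_add]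
    have h2 := ha k
    rcases k.even_or_odd with he | ho
    · rw [he.neg_pow]
      have := he.pow_nonneg x
      positivity
    · rw [ho.neg_pow]
      simp

lemma measurable_zero_nnnorm (hg : Measurable (Function.uncurry g)) :
    Measurable fun w : E d => g 0 ‖w‖₊ :=
  hg.comp (g := Function.uncurry g) (f := fun w : E d => (0, ‖w‖₊)) (by fun_prop)

lemma sampleValue_neg (w : E d) : sampleValue g z (-w) = g (-inner ℝ w z) ‖w‖₊ := by
  simp [sampleValue]

/-- By `HasNonnegCoeffs.gTilde_nonneg`, `g 0 ‖w‖₊` lies between `0` and the average of the sample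
values at `w` and `-w`, both integrable by isotropy. -/
lemma integrable_zero_nnnorm (hν : IsIsotropic ν) (hg : Measurable (Function.uncurry g))
    (hc : HasNonnegCoeffs g) (hf : Integrable (sampleValue g z) ν) :
    Integrable (fun w => g 0 ‖w‖₊) ν := by
  have h1 := (hf.add (hν.integrable_comp (LinearIsometryEquiv.neg ℝ) hf)).div_const 2
  refine h1.mono' (measurable_zero_nnnorm hg).aestronglyMeasurable (ae_of_all _ fun w => ?_)
  rw [Real.norm_eq_abs, abs_of_nonneg (hc.zero_nonneg _)]
  have := hc.gTilde_nonneg (inner ℝ w z) ‖w‖₊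
  simp only [gTilde] at this
  simp only [Pi.add_apply, LinearIsometryEquiv.coe_neg, sampleValue_neg]
  simp only [sampleValue]
  linarith

/-- The reduction term as an expectation with respect to the isotropic law. -/
lemma F_eq (hd : 0 < d) [IsProbabilityMeasure ν] (hν : IsIsotropic ν)
    (hg : Measurable (Function.uncurry g))
    (hc : HasNonnegCoeffs g) (hf : Integrable (sampleValue g z) ν) :
    F g ν z = ∫ w, sampleValue g z w ∂ν - ∫ w, g 0 ‖w‖₊ ∂ν := by
  have := isProbabilityMeasure_unifSphere hd
  have : IsProbabilityMeasure (ν.map (fun w => ‖w‖₊)) :=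
    Measure.isProbabilityMeasure_map (by fun_prop)
  have hneg := hν.integrable_comp (LinearIsometryEquiv.neg ℝ) hf
  have h0 := integrable_zero_nnnorm hν hg hc hf
  -- `H` is `gTilde` written as a function on the whole space. Its mean is found from the symmetry
  -- of `ν`, and its polar decomposition is the iterated integral defining `F`.
  set H : E d → ℝ := fun w =>
    (sampleValue g z w + sampleValue g z (LinearIsometryEquiv.neg ℝ w)) / 2 - g 0 ‖w‖₊ with hH
  have hadd : Integrable (fun w => (sampleValue g z w
      + sampleValue g z (LinearIsometryEquiv.neg ℝ w)) / 2) ν := (hf.add hneg).div_const 2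
  have hHint : Integrable H ν := hadd.sub h0
  have hHval : ∫ w, H w ∂ν = ∫ w, sampleValue g z w ∂ν - ∫ w, g 0 ‖w‖₊ ∂ν := by
    rw [integral_sub hadd h0, integral_div, integral_add hf hneg,
      hν.integral_comp (LinearIsometryEquiv.neg ℝ)]
    ring
  have hpt : ∀ (u : Metric.sphere (0 : E d) 1) (t : ℝ≥0),
      gTilde g ((t : ℝ) * inner ℝ (u : E d) z) t = H ((t : ℝ) • (u : E d)) := by
    intro u t
    have hn : ‖(t : ℝ) • (u : E d)‖₊ = t := by
      ext
      simp [norm_smul]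
    simp only [hH, gTilde, LinearIsometryEquiv.coe_neg, sampleValue_neg, hn]
    simp only [sampleValue, hn, real_inner_smul_left]
  have hmap := hν.map_smul_unifSphere hd
  have hmeas : Measurable fun q : Metric.sphere (0 : E d) 1 × ℝ≥0 => (q.2 : ℝ) • (q.1 : E d) := by
    fun_prop
  rw [← hHval]
  conv_rhs => rw [← hmap]
  rw [← hmap] at hHint
  rw [integral_map hmeas.aemeasurable hHint.aestronglyMeasurable,
    integral_prod (fun q : Metric.sphere (0 : E d) 1 × ℝ≥0 => H ((q.2 : ℝ) • (q.1 : E d)))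
      (hHint.comp_measurable hmeas)]
  simp only [F, hpt]

end SampleValue

end

/-! ### Covariance of two samples of an orthogonal ensemble -/

section

variable {d : ℕ} {g : ℝ → ℝ≥0 → ℝ} {z : E d} {ν : Measure (E d)}

lemma IsIsotropic.integrable_integral_smul {σ : Measure (E d)} (hd : 0 < d)
    [IsProbabilityMeasure ν] [IsProbabilityMeasure σ] (hν : IsIsotropic ν)
    (hσ : IsIsotropic σ) (hσ1 : ∀ᵐ u ∂σ, ‖u‖ = 1) {f : E d → ℝ} (hf : Integrable f ν) :
    Integrable (fun t => ∫ u, f (t • u) ∂σ) (ν.map (fun w => ‖w‖)) ∧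
      ∫ t, ∫ u, f (t • u) ∂σ ∂(ν.map (fun w => ‖w‖)) = ∫ w, f w ∂ν := by
  have : IsProbabilityMeasure (ν.map (fun w => ‖w‖)) :=
    Measure.isProbabilityMeasure_map (by fun_prop)
  have hmap := hν.map_smul_prod hd hσ hσ1
  have hmeas : Measurable fun q : ℝ × E d => q.1 • q.2 := by fun_prop
  have hf' := hf
  rw [← hmap] at hf'
  have hint : Integrable (fun q : ℝ × E d => f (q.1 • q.2)) ((ν.map (fun w => ‖w‖)).prod σ) :=
    hf'.comp_measurable hmeas
  refine ⟨hint.integral_prod_left, ?_⟩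
  conv_rhs => rw [← hmap]
  rw [integral_map hmeas.aemeasurable hf'.aestronglyMeasurable, integral_prod _ hint]

namespace IsOrthonormalPairLaw

variable {π : Measure (E d × E d)}

lemma map_fst (hπ : IsOrthonormalPairLaw π) : IsIsotropic (π.map Prod.fst) ∧
    (∀ᵐ u ∂(π.map Prod.fst), ‖u‖ = 1) := by
  refine ⟨fun T => ?_, ?_⟩
  · have hT : Measurable T := T.continuous.measurable
    conv_rhs => rw [← hπ.map_eq T]
    rw [Measure.map_map hT measurable_fst, Measure.map_map measurable_fst (hT.prodMap hT)]
    rfl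
  · rw [ae_map_iff (by fun_prop) (measurableSet_eq_fun (by fun_prop) (by fun_prop))]
    exact hπ.orthonormal.mono fun q hq => hq.1

lemma map_snd (hπ : IsOrthonormalPairLaw π) : IsIsotropic (π.map Prod.snd) ∧
    (∀ᵐ u ∂(π.map Prod.snd), ‖u‖ = 1) := by
  refine ⟨fun T => ?_, ?_⟩
  · have hT : Measurable T := T.continuous.measurable
    conv_rhs => rw [← hπ.map_eq T]
    rw [Measure.map_map hT measurable_snd, Measure.map_map measurable_snd (hT.prodMap hT)]
    rfl
  · rw [ae_map_iff (by fun_prop) (measurableSet_eq_fun (by fun_prop) (by fun_prop))]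
    exact hπ.orthonormal.mono fun q hq => hq.2.1

/-- The bound for fixed radii: scaling the direction by `s ≥ 0` replaces the coefficients `a k` by
`a k * s ^ k`, which stay nonnegative, and the norm of `s • q.1` is almost surely `s`. -/
lemma integral_sampleValue_smul_mul_le (hπ : IsOrthonormalPairLaw π) (hc : HasNonnegCoeffs g)
    (z : E d) {s t : ℝ} (hs : 0 ≤ s) (ht : 0 ≤ t) :
    ∫ q, sampleValue g z (s • q.1) * sampleValue g z (t • q.2) ∂π
      ≤ (∫ q, sampleValue g z (s • q.1) ∂π) * (∫ q, sampleValue g z (t • q.2) ∂π)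
        - 2 / ((d : ℝ) + 2) * (((∫ q, sampleValue g z (s • q.1) ∂π) - g 0 ‖s‖₊)
          * ((∫ q, sampleValue g z (t • q.2) ∂π) - g 0 ‖t‖₊)) := by
  obtain ⟨a, ha, hsa⟩ := hc ‖s‖₊
  obtain ⟨b, hb, hsb⟩ := hc ‖t‖₊
  have key := hπ.integral_powerSeries_mul_le z
    (φ := fun x => g (s * x) ‖s‖₊) (ψ := fun x => g (t * x) ‖t‖₊)
    (a := fun k => a k * s ^ k) (b := fun k => b k * t ^ k)
    (fun k => mul_nonneg (ha k) (pow_nonneg hs k)) (fun k => mul_nonneg (hb k) (pow_nonneg ht k))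
    (fun x => by simpa only [mul_pow, mul_assoc] using hsa (s * x))
    (fun x => by simpa only [mul_pow, mul_assoc] using hsb (t * x))
  have e1 : ∀ᵐ q ∂π, sampleValue g z (s • q.1) = g (s * inner ℝ q.1 z) ‖s‖₊ := by
    filter_upwards [hπ.orthonormal] with q hq
    have : ‖s • q.1‖₊ = ‖s‖₊ := by ext; simp [norm_smul, hq.1]
    rw [sampleValue, this, real_inner_smul_left]
  have e2 : ∀ᵐ q ∂π, sampleValue g z (t • q.2) = g (t * inner ℝ q.2 z) ‖t‖₊ := by
    filter_upwards [hπ.orthonormal] with q hq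
    have : ‖t • q.2‖₊ = ‖t‖₊ := by ext; simp [norm_smul, hq.2.1]
    rw [sampleValue, this, real_inner_smul_left]
  have e3 : ∀ᵐ q ∂π, sampleValue g z (s • q.1) * sampleValue g z (t • q.2)
      = g (s * inner ℝ q.1 z) ‖s‖₊ * g (t * inner ℝ q.2 z) ‖t‖₊ := by
    filter_upwards [e1, e2] with q h1 h2
    rw [h1, h2]
  rw [integral_congr_ae e1, integral_congr_ae e2, integral_congr_ae e3]
  simpa only [mul_zero] using key

/-- The expected product of the sample values at two orthogonal samples. -/
lemma integral_prod_sampleValue_le (hπ : IsOrthonormalPairLaw π)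
    [IsProbabilityMeasure ν] (hν : IsIsotropic ν)
    (hg : Measurable (Function.uncurry g)) (hc : HasNonnegCoeffs g)
    (hf : Integrable (sampleValue g z) ν)
    (hint : Integrable (fun x : (ℝ × ℝ) × (E d × E d) =>
      sampleValue g z (x.1.1 • x.2.1) * sampleValue g z (x.1.2 • x.2.2))
      (((ν.map (fun w => ‖w‖)).prod (ν.map (fun w => ‖w‖))).prod π)) :
    ∫ x, sampleValue g z (x.1.1 • x.2.1) * sampleValue g z (x.1.2 • x.2.2)
        ∂(((ν.map (fun w => ‖w‖)).prod (ν.map (fun w => ‖w‖))).prod π)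
      ≤ (∫ w, sampleValue g z w ∂ν) ^ 2 - 2 / ((d : ℝ) + 2) * F g ν z ^ 2 := by
  have := hπ.isProbabilityMeasure
  have hd := hπ.dim_pos
  have : IsProbabilityMeasure (ν.map (fun w => ‖w‖)) :=
    Measure.isProbabilityMeasure_map (by fun_prop)
  have : IsProbabilityMeasure (π.map Prod.fst) := Measure.isProbabilityMeasure_map (by fun_prop)
  have : IsProbabilityMeasure (π.map Prod.snd) := Measure.isProbabilityMeasure_map (by fun_prop)
  have hfm := measurable_sampleValue hg z
  obtain ⟨i1, v1⟩ := hν.integrable_integral_smul hd hπ.map_fst.1 hπ.map_fst.2 hf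
  obtain ⟨i2, v2⟩ := hν.integrable_integral_smul hd hπ.map_snd.1 hπ.map_snd.2 hf
  have c1 : ∀ t : ℝ, ∫ u, sampleValue g z (t • u) ∂(π.map Prod.fst)
      = ∫ q, sampleValue g z (t • q.1) ∂π := fun t =>
    integral_map (by fun_prop) (hfm.comp (measurable_const_smul t)).aestronglyMeasurable
  have c2 : ∀ t : ℝ, ∫ u, sampleValue g z (t • u) ∂(π.map Prod.snd)
      = ∫ q, sampleValue g z (t • q.2) ∂π := fun t =>
    integral_map (by fun_prop) (hfm.comp (measurable_const_smul t)).aestronglyMeasurable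
  simp only [c1] at i1 v1
  simp only [c2] at i2 v2
  have hm0 : Measurable fun t : ℝ => g 0 ‖t‖₊ :=
    hg.comp (g := Function.uncurry g) (f := fun t : ℝ => (0, ‖t‖₊)) (by fun_prop)
  have h0 := integrable_zero_nnnorm hν hg hc hf
  have i0 : Integrable (fun t => g 0 ‖t‖₊) (ν.map (fun w => ‖w‖)) := by
    rw [integrable_map_measure hm0.aestronglyMeasurable (by fun_prop)]
    exact h0.congr (ae_of_all _ fun w => by simp)
  have v0 : ∫ t, g 0 ‖t‖₊ ∂(ν.map (fun w => ‖w‖)) = ∫ w, g 0 ‖w‖₊ ∂ν := by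
    rw [integral_map (by fun_prop) hm0.aestronglyMeasurable]
    simp
  have hnn : ∀ᵐ t ∂(ν.map (fun w => ‖w‖)), 0 ≤ t := by
    rw [ae_map_iff (by fun_prop) measurableSet_Ici]
    exact ae_of_all _ fun w => norm_nonneg w
  have a1 := i1.mul_prod i2
  have a2 := ((i1.sub i0).mul_prod (i2.sub i0)).const_mul (2 / ((d : ℝ) + 2))
  simp only [Pi.sub_apply] at a2
  rw [integral_prod _ hint]
  -- The fixed-radii bound is integrated over the independent radii. Both products then factorize,
  -- and each centred factor integrates to `F g ν z`.
  refine (integral_mono_ae hint.integral_prod_left (a1.sub a2) ?_).trans_eq ?_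
  · have q1 := (Measure.quasiMeasurePreserving_fst
      (μ := ν.map (fun w => ‖w‖)) (ν := ν.map (fun w => ‖w‖))).ae hnn
    have q2 := (Measure.quasiMeasurePreserving_snd
      (μ := ν.map (fun w => ‖w‖)) (ν := ν.map (fun w => ‖w‖))).ae hnn
    filter_upwards [q1, q2] with x hx1 hx2
    exact hπ.integral_sampleValue_smul_mul_le hc z hx1 hx2
  · rw [integral_sub' a1 a2, integral_const_mul,
      integral_prod_mul (fun s => ∫ q, sampleValue g z (s • q.1) ∂π)
        (fun t => ∫ q, sampleValue g z (t • q.2) ∂π),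
      integral_prod_mul (fun s => (∫ q, sampleValue g z (s • q.1) ∂π) - g 0 ‖s‖₊)
        (fun t => (∫ q, sampleValue g z (t • q.2) ∂π) - g 0 ‖t‖₊),
      integral_sub i1 i0, integral_sub i2 i0, v0, v1, v2, F_eq hd hν hg hc hf]
    ring

end IsOrthonormalPairLaw

namespace IsOrthogonalEnsemble

variable {Ω ι : Type*} [MeasurableSpace Ω] [Fintype ι] {P : Measure Ω} [IsProbabilityMeasure P]
  {ω : ι → Ω → E d}

/-- A single direction `u i` has an isotropic law on unit vectors and is independent of `r i`, so
the polar decomposition of `ν` applies with this law as angular part. -/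
lemma hasLaw [IsProbabilityMeasure ν] (hν : IsIsotropic ν) (h : IsOrthogonalEnsemble ν P ω)
    (i : ι) : HasLaw (ω i) ν P := by
  obtain ⟨r, u, hu, ho, hT, hr, -, hind, hω⟩ := h
  have hu1 : ∀ᵐ p ∂P, ‖u i p‖ = 1 := ho.mono fun p hp => hp.1 i
  have hd : 0 < d := by
    obtain ⟨p, hp⟩ := hu1.exists
    rcases Nat.eq_zero_or_pos d with rfl | h
    · rw [Subsingleton.elim (u i p) 0, norm_zero] at hp
      norm_num at hp
    · exact h
  have : IsProbabilityMeasure (P.map (u i)) := Measure.isProbabilityMeasure_map (hu i)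
  have hiso : IsIsotropic (P.map (u i)) := by
    intro T
    have h1 := ((hT T).comp (measurable_pi_apply i)).map_eq
    rw [AEMeasurable.map_map_of_aemeasurable T.continuous.measurable.aemeasurable (hu i)]
    exact h1
  have hone : ∀ᵐ w ∂(P.map (u i)), ‖w‖ = 1 := by
    rw [ae_map_iff (hu i) (measurableSet_eq_fun (by fun_prop) (by fun_prop))]
    exact hu1
  have hi : IndepFun (r i) (u i) P :=
    hind.comp (measurable_pi_apply i) (measurable_pi_apply i)
  have hmap := (indepFun_iff_map_prod_eq_prod_map_map (hr i).aemeasurable (hu i)).1 hi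
  have hae : AEMeasurable (fun p => r i p • u i p) P := (hr i).aemeasurable.smul (hu i)
  refine HasLaw.congr ⟨hae, ?_⟩ (hω i)
  have key := hν.map_smul_prod hd hiso hone
  rw [← (hr i).map_eq, ← hmap, AEMeasurable.map_map_of_aemeasurable
    (Measurable.aemeasurable (by fun_prop)) ((hr i).aemeasurable.prodMk (hu i))] at key
  exact key

/-- The joint law of radii and directions is the product of two copies of the radial law and an
orthonormal pair law, which turns the expected product into the integral of
`IsOrthonormalPairLaw.integral_prod_sampleValue_le`. -/
lemma covariance_le [IsProbabilityMeasure ν] (hν : IsIsotropic ν)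
    (h : IsOrthogonalEnsemble ν P ω) (hg : Measurable (Function.uncurry g))
    (hc : HasNonnegCoeffs g) (hf : MemLp (sampleValue g z) 2 ν) {i j : ι} (hij : i ≠ j) :
    cov[fun p => sampleValue g z (ω i p), fun p => sampleValue g z (ω j p); P]
      ≤ -(2 / ((d : ℝ) + 2) * F g ν z ^ 2) := by
  have hi := h.hasLaw hν i
  have hj := h.hasLaw hν j
  have hfm := measurable_sampleValue hg z
  have hL : ∀ k, MemLp (fun p => sampleValue g z (ω k p)) 2 P := fun k => by
    have hk := h.hasLaw hν k
    rw [← hk.map_eq] at hf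
    exact hf.comp_of_map hk.aemeasurable
  have hm : ∀ k, ∫ p, sampleValue g z (ω k p) ∂P = ∫ w, sampleValue g z w ∂ν := fun k =>
    (h.hasLaw hν k).integral_comp hfm.aestronglyMeasurable
  rw [covariance_eq_sub (hL i) (hL j), hm i, hm j]
  obtain ⟨r, u, hu, ho, hT, hr, hrr, hind, hω⟩ := h
  set R : Ω → ℝ × ℝ := fun p => (r i p, r j p)
  set U : Ω → E d × E d := fun p => (u i p, u j p)
  have hRm : AEMeasurable R P := (hr i).aemeasurable.prodMk (hr j).aemeasurable
  have hUm : AEMeasurable U P := (hu i).prodMk (hu j)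
  have hRU : IndepFun R U P :=
    hind.comp ((measurable_pi_apply i).prodMk (measurable_pi_apply j))
      ((measurable_pi_apply i).prodMk (measurable_pi_apply j))
  have hR : P.map R = (ν.map (fun w => ‖w‖)).prod (ν.map (fun w => ‖w‖)) := by
    rw [(indepFun_iff_map_prod_eq_prod_map_map (hr i).aemeasurable (hr j).aemeasurable).1
      (hrr.indepFun hij), (hr i).map_eq, (hr j).map_eq]
  have hπ : IsOrthonormalPairLaw (P.map U) := by
    refine ⟨Measure.isProbabilityMeasure_map hUm, fun T => ?_, ?_⟩
    · have hTm : Measurable T := T.continuous.measurable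
      rw [AEMeasurable.map_map_of_aemeasurable (hTm.prodMap hTm).aemeasurable hUm]
      exact ((hT T).comp ((measurable_pi_apply i).prodMk (measurable_pi_apply j))).map_eq
    · have hmeas : MeasurableSet {q : E d × E d | ‖q.1‖ = 1 ∧ ‖q.2‖ = 1 ∧ inner ℝ q.1 q.2 = 0} :=
        (measurableSet_eq_fun (by fun_prop) (by fun_prop)).inter
          ((measurableSet_eq_fun (by fun_prop) (by fun_prop)).inter
            (measurableSet_eq_fun (by fun_prop) (by fun_prop)))
      rw [ae_map_iff hUm hmeas]
      exact ho.mono fun p hp => ⟨hp.1 i, hp.1 j, hp.2 hij⟩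
  have hRUmap := (indepFun_iff_map_prod_eq_prod_map_map hRm hUm).1 hRU
  rw [hR] at hRUmap
  have hRUm : AEMeasurable (fun p => (R p, U p)) P := hRm.prodMk hUm
  set G : (ℝ × ℝ) × (E d × E d) → ℝ := fun x =>
    sampleValue g z (x.1.1 • x.2.1) * sampleValue g z (x.1.2 • x.2.2) with hG
  have hGm : Measurable G :=
    (hfm.comp (g := sampleValue g z)
      (f := fun x : (ℝ × ℝ) × (E d × E d) => x.1.1 • x.2.1) (by fun_prop)).mul
    (hfm.comp (g := sampleValue g z)
      (f := fun x : (ℝ × ℝ) × (E d × E d) => x.1.2 • x.2.2) (by fun_prop))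
  have hae : (fun p => sampleValue g z (ω i p)) * (fun p => sampleValue g z (ω j p))
      =ᵐ[P] G ∘ fun p => (R p, U p) := by
    filter_upwards [hω i, hω j] with p hp1 hp2
    simp [hG, R, U, hp1, hp2]
  have hint : Integrable G (((ν.map (fun w => ‖w‖)).prod (ν.map (fun w => ‖w‖))).prod
      (P.map U)) := by
    rw [← hRUmap, integrable_map_measure hGm.aestronglyMeasurable hRUm]
    exact ((hL i).integrable_mul (hL j)).congr hae
  have key := hπ.integral_prod_sampleValue_le hν hg hc (hf.integrable one_le_two) hint
  rw [← hRUmap, integral_map hRUm hGm.aestronglyMeasurable] at key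
  have hE : ∫ p, ((fun p => sampleValue g z (ω i p)) * (fun p => sampleValue g z (ω j p))) p ∂P
      = ∫ p, G (R p, U p) ∂P := integral_congr_ae hae
  rw [hE]
  linarith

end IsOrthogonalEnsemble

end

/-! ### Mean and variance of the estimators -/

section

section Estimator

variable {d M : ℕ} {Ω : Type*} [MeasurableSpace Ω] {P : Measure Ω}
  {ν : Measure (E d)} {h : E d → ℝ} {ω : Fin M → Ω → E d}

lemma memLp_comp_of_hasLaw {X : Ω → E d} (hX : HasLaw X ν P) (hh : MemLp h 2 ν) :
    MemLp (fun p => h (X p)) 2 P := by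
  rw [← hX.map_eq] at hh
  exact hh.comp_of_map hX.aemeasurable

lemma memLp_estimator (hω : ∀ m, HasLaw (ω m) ν P) (hh : MemLp h 2 ν) :
    MemLp (estimator h ω) 2 P :=
  (memLp_finsetSum _ fun m _ => memLp_comp_of_hasLaw (hω m) hh).const_mul _

variable [IsProbabilityMeasure P]

lemma integral_estimator (hM : 1 ≤ M) (hω : ∀ m, HasLaw (ω m) ν P) (hh : MemLp h 2 ν) :
    ∫ p, estimator h ω p ∂P = ∫ w, h w ∂ν := by
  have hM0 : (M : ℝ) ≠ 0 := by exact_mod_cast (by omega : M ≠ 0)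
  have h1 : ∀ m, ∫ p, h (ω m p) ∂P = ∫ w, h w ∂ν := fun m =>
    (hω m).integral_comp hh.aestronglyMeasurable
  have h2 : ∀ m ∈ Finset.univ, Integrable (fun p => h (ω m p)) P := fun m _ => by
    exact (memLp_comp_of_hasLaw (hω m) hh).integrable one_le_two
  simp only [estimator]
  rw [integral_const_mul, integral_finsetSum _ h2]
  simp only [h1, Finset.sum_const, Finset.card_univ, Fintype.card_fin, nsmul_eq_mul]
  field_simp

lemma variance_estimator (hω : ∀ m, HasLaw (ω m) ν P) (hh : MemLp h 2 ν) :
    Var[estimator h ω; P] = (1 / (M : ℝ)) ^ 2 *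
      ∑ m, (Var[h; ν] + ∑ n ∈ Finset.univ.erase m,
        cov[fun p => h (ω m p), fun p => h (ω n p); P]) := by
  have hL := fun m => memLp_comp_of_hasLaw (hω m) hh
  have h1 : Var[estimator h ω; P]
      = (1 / (M : ℝ)) ^ 2 * Var[fun p => ∑ m, h (ω m p); P] := variance_const_mul _ _ _
  rw [h1, variance_fun_sum hL]
  congr 1
  refine Finset.sum_congr rfl fun m _ => ?_
  rw [← Finset.add_sum_erase _ _ (Finset.mem_univ m), covariance_self (hL m).aemeasurable]
  congr 1
  have hh' := hh.aestronglyMeasurable.aemeasurable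
  rw [← (hω m).map_eq] at hh' ⊢
  exact (variance_map hh' (hω m).aemeasurable).symm

/-- Bounding the variance of the estimator through the pairwise covariances. -/
lemma variance_estimator_le (hM : 1 ≤ M) (hω : ∀ m, HasLaw (ω m) ν P) (hh : MemLp h 2 ν)
    {c : ℝ} (hc : ∀ m n, m ≠ n → cov[fun p => h (ω m p), fun p => h (ω n p); P] ≤ c) :
    Var[estimator h ω; P] ≤ Var[h; ν] / M + (1 - 1 / (M : ℝ)) * c := by
  have hM0 : (0 : ℝ) < M := by exact_mod_cast hM
  rw [variance_estimator hω hh]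
  calc _ ≤ (1 / (M : ℝ)) ^ 2 * ∑ m : Fin M, (Var[h; ν] + ∑ n ∈ Finset.univ.erase m, c) := by
        gcongr with m _ n hn
        exact hc m n (Finset.ne_of_mem_erase hn).symm
    _ = _ := by
        simp only [Finset.sum_const, Finset.card_erase_of_mem (Finset.mem_univ _),
          Finset.card_univ, Fintype.card_fin, nsmul_eq_mul, Nat.cast_sub hM]
        field_simp
        push_cast
        ring

lemma variance_estimator_iid (hM : 1 ≤ M) (hω : IsIIDSample ν P ω) (hm : Measurable h)
    (hh : MemLp h 2 ν) : Var[estimator h ω; P] = Var[h; ν] / M := by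
  have hM0 : (0 : ℝ) < M := by exact_mod_cast hM
  rw [variance_estimator hω.1 hh]
  have h1 : ∀ m : Fin M, ∀ n ∈ Finset.univ.erase m,
      cov[fun p => h (ω m p), fun p => h (ω n p); P] = 0 := fun m n hn =>
    ((hω.2.indepFun (Finset.ne_of_mem_erase hn).symm).comp hm hm).covariance_eq_zero
      (memLp_comp_of_hasLaw (hω.1 m) hh) (memLp_comp_of_hasLaw (hω.1 n) hh)
  simp only [Finset.sum_congr rfl (h1 _), Finset.sum_const_zero, add_zero, Finset.sum_const,
    Finset.card_univ, Fintype.card_fin, nsmul_eq_mul]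
  field_simp

end Estimator

section Block

variable {d M : ℕ} {Ω : Type*} [MeasurableSpace Ω] {P : Measure Ω} [IsProbabilityMeasure P]
  {ν : Measure (E d)} [IsProbabilityMeasure ν] {g : ℝ → ℝ≥0 → ℝ} {z : E d} {ω : Fin M → Ω → E d}

lemma IsBlockOrthogonalEnsemble.hasLaw (hν : IsIsotropic ν)
    (h : IsBlockOrthogonalEnsemble ν P ω) (m : Fin M) : HasLaw (ω m) ν P :=
  (h.1 ((m : ℕ) / d)).hasLaw hν ⟨m, rfl⟩

/-- Within one block the orthogonal bound applies and its gain is nonnegative; samples from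
different blocks are independent. -/
lemma IsBlockOrthogonalEnsemble.covariance_nonpos (hν : IsIsotropic ν)
    (h : IsBlockOrthogonalEnsemble ν P ω) (hg : Measurable (Function.uncurry g))
    (hc : HasNonnegCoeffs g) (hf : MemLp (sampleValue g z) 2 ν) {m n : Fin M} (hmn : m ≠ n) :
    cov[fun p => sampleValue g z (ω m p), fun p => sampleValue g z (ω n p); P] ≤ 0 := by
  have hfm := measurable_sampleValue hg z
  by_cases hb : (m : ℕ) / d = (n : ℕ) / d
  · refine ((h.1 ((n : ℕ) / d)).covariance_le hν hg hc hf
      (i := ⟨m, hb⟩) (j := ⟨n, rfl⟩) (by simpa using hmn)).trans ?_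
    rw [neg_nonpos]
    positivity
  · have h1 : IndepFun (ω m) (ω n) P :=
      (h.2.indepFun hb).comp
        (measurable_pi_apply (⟨m, rfl⟩ : {k : Fin M // (k : ℕ) / d = (m : ℕ) / d}))
        (measurable_pi_apply (⟨n, rfl⟩ : {k : Fin M // (k : ℕ) / d = (n : ℕ) / d}))
    exact ((h1.comp hfm hfm).covariance_eq_zero (memLp_comp_of_hasLaw (h.hasLaw hν m) hf)
      (memLp_comp_of_hasLaw (h.hasLaw hν n) hf)).le

lemma IsOrthogonalEnsemble.variance_estimator_le (hM : 1 ≤ M) (hν : IsIsotropic ν)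
    (h : IsOrthogonalEnsemble ν P ω) (hg : Measurable (Function.uncurry g))
    (hc : HasNonnegCoeffs g) (hf : MemLp (sampleValue g z) 2 ν) :
    Var[estimator (sampleValue g z) ω; P] ≤ Var[sampleValue g z; ν] / M
      - (1 - 1 / (M : ℝ)) * (2 / ((d : ℝ) + 2)) * F g ν z ^ 2 := by
  refine (OrthRF.variance_estimator_le hM (h.hasLaw hν) hf
    fun m n hmn => h.covariance_le hν hg hc hf hmn).trans_eq ?_
  ring

end Block

end

/-! ### Gaussian integrals and optimal positive random features -/

section

section GaussianExp

/-- Completing the square: with `v = 1 / (1 - 2 * a)`, the tilted standard density is a multiple of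
the density with mean `c * v` and variance `v`. -/
lemma exp_quadratic_mul_gaussianPDFReal {a c : ℝ} {v : ℝ≥0} (hv : (v : ℝ) * (1 - 2 * a) = 1)
    (x : ℝ) : gaussianPDFReal 0 1 x * Real.exp (a * x ^ 2 + c * x)
      = Real.sqrt v * Real.exp (c ^ 2 * v / 2) * gaussianPDFReal (c * v) v x := by
  have hv0 : (v : ℝ) ≠ 0 := left_ne_zero_of_mul (hv.trans_ne one_ne_zero)
  have hvpos : (0 : ℝ) < v := lt_of_le_of_ne v.coe_nonneg hv0.symm
  have ha : a = (1 - 1 / (v : ℝ)) / 2 := by field_simp; linarith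
  simp only [gaussianPDFReal, NNReal.coe_one, mul_one]
  rw [Real.sqrt_mul (by positivity) (v : ℝ), mul_inv]
  have hs : Real.sqrt v ≠ 0 := (Real.sqrt_pos.2 hvpos).ne'
  have e : -(x - 0) ^ 2 / 2 + (a * x ^ 2 + c * x)
      = c ^ 2 * v / 2 + -(x - c * v) ^ 2 / (2 * v) := by
    rw [ha]
    field_simp
    ring
  rw [mul_assoc, ← Real.exp_add, e, Real.exp_add]
  field_simp

lemma integrable_exp_quadratic_gaussianReal {a c : ℝ} {v : ℝ≥0}
    (hv : (v : ℝ) * (1 - 2 * a) = 1) :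
    Integrable (fun x => Real.exp (a * x ^ 2 + c * x)) (gaussianReal 0 1) := by
  rw [gaussianReal_of_var_ne_zero _ one_ne_zero,
    integrable_withDensity_iff_integrable_smul' (measurable_gaussianPDF _ _)
      (ae_of_all _ fun _ => gaussianPDF_lt_top)]
  simp only [toReal_gaussianPDF, smul_eq_mul, exp_quadratic_mul_gaussianPDFReal hv]
  exact (integrable_gaussianPDFReal _ _).const_mul _

lemma integral_exp_quadratic_gaussianReal {a c : ℝ} {v : ℝ≥0}
    (hv : (v : ℝ) * (1 - 2 * a) = 1) :
    ∫ x, Real.exp (a * x ^ 2 + c * x) ∂(gaussianReal 0 1)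
      = Real.sqrt v * Real.exp (c ^ 2 * v / 2) := by
  have hv0 : v ≠ 0 := by
    rintro rfl
    simp at hv
  rw [integral_gaussianReal_eq_integral_smul one_ne_zero]
  simp only [smul_eq_mul, exp_quadratic_mul_gaussianPDFReal hv]
  rw [integral_const_mul, integral_gaussianPDFReal_eq_one _ hv0, mul_one]

variable {d : ℕ}

lemma exp_quadratic_eq_prod (a b : ℝ) (z : E d) (x : Fin d → ℝ) :
    Real.exp (a * ‖WithLp.toLp 2 x‖ ^ 2 + b * inner ℝ (WithLp.toLp 2 x) z)
      = ∏ i, Real.exp (a * x i ^ 2 + (b * z i) * x i) := by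
  rw [← Real.exp_sum, EuclideanSpace.norm_sq_eq, PiLp.inner_apply, Finset.mul_sum,
    Finset.mul_sum, ← Finset.sum_add_distrib]
  congr 1
  refine Finset.sum_congr rfl fun i _ => ?_
  simp
  ring

lemma integrable_exp_quadratic_stdGaussian {a : ℝ} (ha : a < 1 / 2) (b : ℝ) (z : E d) :
    Integrable (fun w => Real.exp (a * ‖w‖ ^ 2 + b * inner ℝ w z)) (stdGaussian (E d)) := by
  rw [← map_pi_eq_stdGaussian, integrable_map_measure (by fun_prop)
    (Measurable.aemeasurable (by fun_prop))]
  have h : (1 / (1 - 2 * a)) * (1 - 2 * a) = 1 := by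
    have : 1 - 2 * a ≠ 0 := by linarith
    field_simp
  have h0 : 0 ≤ 1 / (1 - 2 * a) := by
    have : 0 < 1 - 2 * a := by linarith
    positivity
  refine (Integrable.fintype_prod (f := fun i x => Real.exp (a * x ^ 2 + (b * z i) * x))
    fun i => integrable_exp_quadratic_gaussianReal (v := ⟨1 / (1 - 2 * a), h0⟩) h).congr
    (ae_of_all _ fun x => ?_)
  exact (exp_quadratic_eq_prod a b z x).symm

lemma integral_exp_quadratic_stdGaussian {a : ℝ} {v : ℝ≥0} (hv : (v : ℝ) * (1 - 2 * a) = 1)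
    (b : ℝ) (z : E d) :
    ∫ w, Real.exp (a * ‖w‖ ^ 2 + b * inner ℝ w z) ∂(stdGaussian (E d))
      = Real.sqrt v ^ d * Real.exp (b ^ 2 * v * ‖z‖ ^ 2 / 2) := by
  rw [← map_pi_eq_stdGaussian, integral_map (Measurable.aemeasurable (by fun_prop))
    (by fun_prop)]
  simp only [exp_quadratic_eq_prod]
  rw [integral_fintype_prod_eq_prod (f := fun i x => Real.exp (a * x ^ 2 + (b * z i) * x))]
  simp only [integral_exp_quadratic_gaussianReal hv]
  rw [Finset.prod_mul_distrib, Finset.prod_const, Finset.card_univ, Fintype.card_fin,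
    ← Real.exp_sum, EuclideanSpace.norm_sq_eq, Finset.mul_sum, Finset.sum_div]
  congr 2
  refine Finset.sum_congr rfl fun i _ => ?_
  simp
  ring

end GaussianExp

section OPRF

variable {d : ℕ}

lemma rhoStar_pos (hd : 0 < d) {q : ℝ} (hq : 0 ≤ q) : 0 < rhoStar d q := by
  rw [rhoStar]
  split_ifs with h
  · exact one_pos
  · have hq' : 0 < q := lt_of_le_of_ne hq (Ne.symm h)
    have hd' : (0 : ℝ) < d := by exact_mod_cast hd
    have h1 : 2 * q + d < Real.sqrt ((2 * q + d) ^ 2 + 8 * d * q) := by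
      apply Real.lt_sqrt_of_sq_lt
      have : 0 < 8 * d * q := by positivity
      linarith
    apply div_pos <;> linarith

/-- The squared summand grows like `exp (4 * A * ‖w‖ ^ 2)`, which is Gaussian-integrable exactly
when `A < 1 / 8`. Positivity of `rhoStar` is the only property of the optimal parameter that enters.
-/
lemma oprfA_lt (hd : 0 < d) (x y : E d) : oprfA x y < 1 / 8 := by
  have h := one_div_pos.2 (rhoStar_pos hd (sq_nonneg ‖x + y‖))
  rw [oprfA]
  linarith

lemma oprfProduct_eq_sampleValue (x y : E d) :
    oprfProduct x y = sampleValue (oprfG x y) (x + y) := by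
  ext w
  simp only [oprfProduct, geFeature, sampleValue, oprfG, coe_nnnorm, inner_add_right]
  rw [mul_mul_mul_comm, ← Real.exp_add, sq (oprfD x y)]
  congr 2
  ring

lemma measurable_oprfG (x y : E d) : Measurable (Function.uncurry (oprfG x y)) := by
  unfold oprfG Function.uncurry
  fun_prop

lemma hasNonnegCoeffs_oprfG (x y : E d) : HasNonnegCoeffs (oprfG x y) := by
  intro b
  refine ⟨fun k => oprfD x y ^ 2 * Real.exp (2 * oprfA x y * (b : ℝ) ^ 2 - (‖x‖ ^ 2 + ‖y‖ ^ 2))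
    * (oprfB x y ^ k / k.factorial), fun k => ?_, fun t => ?_⟩
  · have : 0 ≤ oprfB x y := Real.sqrt_nonneg _
    positivity
  · have h := (NormedSpace.expSeries_div_hasSum_exp (oprfB x y * t)).mul_left
      (oprfD x y ^ 2 * Real.exp (2 * oprfA x y * (b : ℝ) ^ 2 - (‖x‖ ^ 2 + ‖y‖ ^ 2)))
    rw [← Real.exp_eq_exp_ℝ, mul_assoc (oprfD x y ^ 2), ← Real.exp_add] at h
    have e : oprfG x y t b = oprfD x y ^ 2 * Real.exp (2 * oprfA x y * (b : ℝ) ^ 2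
        - (‖x‖ ^ 2 + ‖y‖ ^ 2) + oprfB x y * t) := by
      rw [oprfG]
      congr 2
      ring
    rw [e]
    refine Eq.subst (motive := fun f : ℕ → ℝ => HasSum f _) (funext fun k => ?_) h
    ring

lemma oprfG_eq (x y : E d) (t : ℝ) (b : ℝ≥0) :
    oprfG x y t b = oprfD x y ^ 2 * Real.exp (-(‖x‖ ^ 2 + ‖y‖ ^ 2))
      * Real.exp (2 * oprfA x y * (b : ℝ) ^ 2 + oprfB x y * t) := by
  rw [oprfG, mul_assoc (oprfD x y ^ 2), ← Real.exp_add]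
  congr 2
  ring

lemma memLp_sampleValue_oprfG (hd : 0 < d) (x y : E d) :
    MemLp (sampleValue (oprfG x y) (x + y)) 2 (stdGaussian (E d)) := by
  rw [memLp_two_iff_integrable_sq (measurable_sampleValue (measurable_oprfG x y)
    _).aestronglyMeasurable]
  have hA := oprfA_lt hd x y
  refine ((integrable_exp_quadratic_stdGaussian (a := 4 * oprfA x y) (by linarith)
    (2 * oprfB x y) (x + y)).const_mul
      ((oprfD x y ^ 2 * Real.exp (-(‖x‖ ^ 2 + ‖y‖ ^ 2))) ^ 2)).congr (ae_of_all _ fun w => ?_)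
  simp only [sampleValue, oprfG_eq, coe_nnnorm]
  rw [mul_pow _ (Real.exp (2 * _ * _ + _)), ← Real.exp_nat_mul (2 * _ * _ + _)]
  congr 2
  push_cast
  ring

/-- The normalization `D ^ 2 = (1 - 4 * A) ^ (d / 2)` cancels the factor `√v ^ d` of the Gaussian
integral, where `v = 1 / (1 - 4 * A)`. -/
lemma oprfD_sq_mul (hd : 0 < d) (x y : E d) {v : ℝ≥0}
    (hv : (v : ℝ) * (1 - 2 * (2 * oprfA x y)) = 1) :
    oprfD x y ^ 2 * Real.sqrt v ^ d = 1 := by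
  have hA := oprfA_lt hd x y
  have hpos : 0 < 1 - 4 * oprfA x y := by linarith
  have h1 : (v : ℝ) = (1 - 4 * oprfA x y)⁻¹ := by
    refine eq_inv_of_mul_eq_one_left ?_
    linear_combination hv
  rw [h1, oprfD, ← Real.rpow_natCast, ← Real.rpow_mul hpos.le, Real.sqrt_inv, inv_pow,
    Real.sqrt_eq_rpow, ← Real.rpow_natCast, ← Real.rpow_mul hpos.le]
  rw [show (d : ℝ) / 4 * (2 : ℕ) = 1 / 2 * d by push_cast; ring]
  exact mul_inv_cancel₀ (Real.rpow_pos_of_pos hpos _).ne'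

/-- The explicit reduction term for optimal positive random features. -/
lemma F_oprfG (x y : E d) :
    F (oprfG x y) (stdGaussian (E d)) (x + y)
      = Real.exp (-(‖x‖ ^ 2 + ‖y‖ ^ 2)) * (Real.exp (‖x + y‖ ^ 2 / 2) - 1) := by
  rcases Nat.eq_zero_or_pos d with rfl | hd
  -- In dimension zero the sphere is empty, so `F` is zero, and the right side vanishes because `x =
  -- y = 0`.
  · have : IsEmpty (Metric.sphere (0 : E 0) 1) := ⟨fun u => by
      have h := mem_sphere_zero_iff_norm.1 u.2
      rw [Subsingleton.elim (u : E 0) 0, norm_zero] at h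
      norm_num at h⟩
    rw [Subsingleton.elim x 0, Subsingleton.elim y 0, F, Measure.eq_zero_of_isEmpty (unifSphere 0)]
    simp
  · have hA := oprfA_lt hd x y
    have hpos : 0 < 1 - 2 * (2 * oprfA x y) := by linarith
    obtain ⟨v, hv⟩ : ∃ v : ℝ≥0, (v : ℝ) * (1 - 2 * (2 * oprfA x y)) = 1 :=
      ⟨⟨(1 - 2 * (2 * oprfA x y))⁻¹, (inv_pos.2 hpos).le⟩, inv_mul_cancel₀ hpos.ne'⟩
    -- This makes the exponent of the Gaussian integral exactly `‖x + y‖ ^ 2 / 2`.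
    have hB : oprfB x y ^ 2 * v = 1 := by
      rw [oprfB, Real.sq_sqrt (by linarith)]
      linear_combination hv
    have hD := oprfD_sq_mul hd x y hv
    rw [F_eq hd isIsotropic_stdGaussian (measurable_oprfG x y) (hasNonnegCoeffs_oprfG x y)
      ((memLp_sampleValue_oprfG hd x y).integrable one_le_two)]
    have h1 : ∫ w, sampleValue (oprfG x y) (x + y) w ∂(stdGaussian (E d))
        = oprfD x y ^ 2 * Real.exp (-(‖x‖ ^ 2 + ‖y‖ ^ 2))
          * (Real.sqrt v ^ d * Real.exp (‖x + y‖ ^ 2 / 2)) := by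
      simp only [sampleValue, oprfG_eq, coe_nnnorm]
      rw [integral_const_mul, integral_exp_quadratic_stdGaussian hv, hB, one_mul]
    have h2 : ∫ w : E d, oprfG x y 0 ‖w‖₊ ∂(stdGaussian (E d))
        = oprfD x y ^ 2 * Real.exp (-(‖x‖ ^ 2 + ‖y‖ ^ 2)) * Real.sqrt v ^ d := by
      simp only [oprfG_eq, coe_nnnorm, mul_zero]
      rw [integral_const_mul]
      congr 1
      simpa using integral_exp_quadratic_stdGaussian hv 0 (0 : E d)
    rw [h1, h2]
    linear_combination (Real.exp (-(‖x‖ ^ 2 + ‖y‖ ^ 2)) * (Real.exp (‖x + y‖ ^ 2 / 2) - 1)) * hD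

end OPRF

end

end OrthRF

end

theorem theorem4 (d M : ℕ) (hM : 1 ≤ M)
    {Ω₁ Ω₂ : Type*} [MeasurableSpace Ω₁] [MeasurableSpace Ω₂]
    (P₁ : Measure Ω₁) (P₂ : Measure Ω₂) [IsProbabilityMeasure P₁] [IsProbabilityMeasure P₂]
    (ωiid : Fin M → Ω₁ → OrthRF.E d) (ωort : Fin M → Ω₂ → OrthRF.E d) :
    -- the general result, for isotropic samples and `M ≤ d`
    (∀ (ν : Measure (OrthRF.E d)) (_ : IsProbabilityMeasure ν) (g : ℝ → ℝ≥0 → ℝ)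
        (z : OrthRF.E d),
      M ≤ d →
      OrthRF.IsIsotropic ν →
      Measurable (Function.uncurry g) →
      OrthRF.HasNonnegCoeffs g →
      MemLp (OrthRF.sampleValue g z) 2 ν →
      OrthRF.IsIIDSample ν P₁ ωiid →
      OrthRF.IsOrthogonalEnsemble ν P₂ ωort →
      MemLp (OrthRF.estimator (OrthRF.sampleValue g z) ωiid) 2 P₁ ∧
      MemLp (OrthRF.estimator (OrthRF.sampleValue g z) ωort) 2 P₂ ∧
      ∫ p, OrthRF.estimator (OrthRF.sampleValue g z) ωiid p ∂P₁
        = ∫ w, OrthRF.sampleValue g z w ∂ν ∧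
      ∫ p, OrthRF.estimator (OrthRF.sampleValue g z) ωort p ∂P₂
        = ∫ w, OrthRF.sampleValue g z w ∂ν ∧
      variance (OrthRF.estimator (OrthRF.sampleValue g z) ωort) P₂
        ≤ variance (OrthRF.estimator (OrthRF.sampleValue g z) ωiid) P₁
          - (1 - 1 / (M : ℝ)) * (2 / ((d : ℝ) + 2)) * OrthRF.F g ν z ^ 2) ∧
    -- optimal positive random features, Gaussian orthogonal ensemble, `M ≤ d`
    (∀ x y : OrthRF.E d,
      M ≤ d →
      OrthRF.IsIIDSample (stdGaussian (OrthRF.E d)) P₁ ωiid →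
      OrthRF.IsOrthogonalEnsemble (stdGaussian (OrthRF.E d)) P₂ ωort →
      variance (OrthRF.estimator (OrthRF.oprfProduct x y) ωort) P₂
        ≤ variance (OrthRF.estimator (OrthRF.oprfProduct x y) ωiid) P₁
          - (1 - 1 / (M : ℝ)) * (2 / ((d : ℝ) + 2))
            * OrthRF.F (OrthRF.oprfG x y) (stdGaussian (OrthRF.E d)) (x + y) ^ 2) ∧
    -- the explicit value of the reduction term for optimal positive random features
    (∀ x y : OrthRF.E d,
      OrthRF.F (OrthRF.oprfG x y) (stdGaussian (OrthRF.E d)) (x + y)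
        = Real.exp (-(‖x‖ ^ 2 + ‖y‖ ^ 2)) * (Real.exp (‖x + y‖ ^ 2 / 2) - 1)) ∧
    -- optimal positive random features, Gaussian block-orthogonal ensemble, any `M`
    (∀ x y : OrthRF.E d,
      1 ≤ d →
      OrthRF.IsIIDSample (stdGaussian (OrthRF.E d)) P₁ ωiid →
      OrthRF.IsBlockOrthogonalEnsemble (stdGaussian (OrthRF.E d)) P₂ ωort →
      variance (OrthRF.estimator (OrthRF.oprfProduct x y) ωort) P₂
        ≤ variance (OrthRF.estimator (OrthRF.oprfProduct x y) ωiid) P₁) := by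
  refine ⟨?_, ?_, fun x y => OrthRF.F_oprfG x y, ?_⟩
  · intro ν _ g z _ hν hg hc hf hiid hort
    refine ⟨OrthRF.memLp_estimator hiid.1 hf, OrthRF.memLp_estimator (hort.hasLaw hν) hf,
      OrthRF.integral_estimator hM hiid.1 hf, OrthRF.integral_estimator hM (hort.hasLaw hν) hf, ?_⟩
    rw [OrthRF.variance_estimator_iid hM hiid (OrthRF.measurable_sampleValue hg z) hf]
    exact hort.variance_estimator_le hM hν hg hc hf
  · intro x y hMd hiid hort
    have hf := OrthRF.memLp_sampleValue_oprfG (by omega) x y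
    have hg := OrthRF.measurable_oprfG x y
    rw [OrthRF.oprfProduct_eq_sampleValue,
      OrthRF.variance_estimator_iid hM hiid (OrthRF.measurable_sampleValue hg _) hf]
    exact hort.variance_estimator_le hM OrthRF.isIsotropic_stdGaussian hg
      (OrthRF.hasNonnegCoeffs_oprfG x y) hf
  · intro x y hd hiid hort
    have hf := OrthRF.memLp_sampleValue_oprfG hd x y
    have hg := OrthRF.measurable_oprfG x y
    have hν := OrthRF.isIsotropic_stdGaussian (d := d)
    rw [OrthRF.oprfProduct_eq_sampleValue,
      OrthRF.variance_estimator_iid hM hiid (OrthRF.measurable_sampleValue hg _) hf]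
    -- The covariance bound is used with constant `0`.
    simpa using OrthRF.variance_estimator_le hM (hort.hasLaw hν) hf
      fun m n hmn => hort.covariance_nonpos hν hg (OrthRF.hasNonnegCoeffs_oprfG x y) hf hmn
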